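/- Let $k\in\{2,3,4,6\}$ and let $\Gamma_k=\mathbb{Z}^2\rtimes\mathbb{Z}/k\mathbb{Z}$, where the generator of $\mathbb{Z}/k\mathbb{Z}$ acts on $\mathbb{Z}^2$ by the matrix $\begin{pmatrix}-1&0\\0&-1\end{pmatrix}$, $\begin{pmatrix}0&-1\\1&-1\end{pmatrix}$, $\begin{pmatrix}0&-1\\1&0\end{pmatrix}$, $\begin{pmatrix}0&-1\\1&1\end{pmatrix}$ for $k=2,3,4,6$ respectively. Write $\Lambda(\Gamma_k)=\mathbb{Z}^2$ for the translation subgroup, call the elements of $\Gamma_k\setminus\Lambda(\Gamma_k)$ rotations, and for a subgroup $\Gamma'\le\Gamma_k$ put $\Lambda(\Gamma')=\Gamma'\cap\Lambda(\Gamma_k)$, and $T(\Gamma')=0$ if $\Gamma'$ contains a rotation, $T(\Gamma')=2$ otherwise. Let $\operatorname{rep}_{\Gamma_k}(\Gamma')$ be the dimension of the space of those homomorphisms $\Gamma'\to\operatorname{Euc}(2)=\mathbb{R}^2\rtimes O(2)$ that extend to a discrete faithful representation $\Gamma_k\to\operatorname{Euc}(2)$. A $\Gamma_k$-colored graph $(G,\boldsymbol{\gamma})$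 is a finite directed multigraph $G$ (self-loops and multiple edges allowed) with an element $\gamma_e\in\Gamma_k$ assigned to every edge $e$. For a closed walk $P$ crossing the edges $e_1,\dots,e_t$ in this order, put $\rho(P)=\gamma_{e_1}^{\epsilon_1}\cdots\gamma_{e_t}^{\epsilon_t}$, where $\epsilon_i=1$ if $e_i$ is crossed from tail to head and $\epsilon_i=-1$ otherwise. Let $G_1,\dots,G_c$ be the connected components of $G$, choose a base vertex $b_i$ in each $G_i$, and let $\rho(\pi_1(G_i,b_i))\le\Gamma_k$ be the subgroup of all values of $\rho$ on closed walks at $b_i$. Put $T(G_i)=T(\rho(\pi_1(G_i,b_i)))$ and $\operatorname{rep}_{\Gamma_k}(G)=\operatorname{rep}_{\Gamma_k}\big(\langle \Lambda(\rho(\pi_1(G_i,b_i))) : 1\le i\le c\rangle\big)$ (these numbers do not depend on the base vertices), and, with $n$ the number of vertices of $G$, $$f(G)=2n+\operatorname{rep}_{\Gamma_k}(G)-\sum_{i=1}^{c}T(G_i).$$ $(G,\boldsymbol{\gamma})$ with $n$ vertices is a $\Gamma$-$(2,2)$ graph if it has exactly $2n+\operatorname{rep}_{\Gamma_k}(\Lambda(\Gamma_k))$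 edges and every subgraph $G'$ of $G$ (not necessarily connected, induced or spanning), with $m'$ edges, satisfies $m'\le f(G')$. $(G,\boldsymbol{\gamma})$ is a $\Gamma$-$(1,1)$ graph if (i) $G$ is a spanning map-graph (a graph in which every connected component has exactly one cycle, a self-loop counting as a cycle) plus $\tfrac12\operatorname{rep}_{\Gamma_k}(\Lambda(\Gamma_k))$ additional edges; (ii) for each connected component $G_i$ of $G$, the group $\rho(\pi_1(G_i,b_i))$ contains a rotation; and (iii) $\operatorname{rep}_{\Gamma_k}(G)=\operatorname{rep}_{\Gamma_k}(\Lambda(\Gamma_k))$. Proposition. Let $(G,\boldsymbol{\gamma})$ be a $\Gamma_k$-colored graph. Then $(G,\boldsymbol{\gamma})$ is a $\Gamma$-$(2,2)$ graph if and only if it is the edge-disjoint union of two spanning $\Gamma$-$(1,1)$ graphs (that is, its edge set is the disjoint union of two sets, each of which forms, together with all the vertices of $G$, a $\Gamma$-$(1,1)$ graph). -/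

import Mathlib

noncomputable section

namespace CrystRig

/-! ### The crystallographic groups `Γ_k` -/

/-- The integer matrix by which the generator of `ℤ/kℤ` acts on `ℤ²`, for `k = 2, 3, 4, 6`
(and the identity matrix for all other values, which are not used). -/
def rotMatrix (k : ℕ) : Matrix (Fin 2) (Fin 2) ℤ :=
  if k = 2 then !![-1, 0; 0, -1]
  else if k = 3 then !![0, -1; 1, -1]
  else if k = 4 then !![0, -1; 1, 0]
  else if k = 6 then !![0, -1; 1, 1]
  else 1

theorem rotMatrix_det (k : ℕ) : (rotMatrix k).det = 1 := by
  unfold rotMatrix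
  split_ifs <;> simp [Matrix.det_fin_two]

theorem rotMatrix_pow (k : ℕ) : rotMatrix k ^ k = 1 := by
  unfold rotMatrix
  split_ifs with h2 h3 h4 h6
  · subst h2; decide
  · subst h3; decide
  · subst h4; decide
  · subst h6; decide
  · exact one_pow k

/-- The matrix `rotMatrix k` as an element of `SL(2, ℤ)`. -/
def rotMat (k : ℕ) : Matrix.SpecialLinearGroup (Fin 2) ℤ := ⟨rotMatrix k, rotMatrix_det k⟩

theorem rotMat_pow (k : ℕ) : rotMat k ^ k = 1 := by
  apply Subtype.ext
  rw [Matrix.SpecialLinearGroup.coe_pow, Matrix.SpecialLinearGroup.coe_one]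
  exact rotMatrix_pow k

/-- The action of `SL(2, ℤ)` on `ℤ²`, with `ℤ²` written multiplicatively. -/
def slAct : Matrix.SpecialLinearGroup (Fin 2) ℤ →* MulAut (Multiplicative (Fin 2 → ℤ)) where
  toFun A := AddEquiv.toMultiplicative (Matrix.SpecialLinearGroup.toLin' A).toAddEquiv
  map_one' := by
    ext x : 1
    simp [AddEquiv.toMultiplicative]
  map_mul' A B := by
    ext x : 1
    simp [AddEquiv.toMultiplicative]

/-- The action of `ℤ/kℤ` on `ℤ²`, the generator acting by `rotMat k`. -/
def rotAct (k : ℕ) : Multiplicative (ZMod k) →* MulAut (Multiplicative (Fin 2 → ℤ)) where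
  toFun r := slAct (rotMat k ^ (Multiplicative.toAdd r).val)
  map_one' := by simp
  map_mul' r s := by
    rw [← map_mul, ← pow_add]
    congr 1
    rcases Nat.eq_zero_or_pos k with rfl | hk
    · have h : rotMat 0 = 1 := Subtype.ext (by simp [rotMat, rotMatrix])
      simp [h]
    · have : NeZero k := ⟨hk.ne'⟩
      rw [toAdd_mul, ZMod.val_add, ← pow_mod_orderOf,
        Nat.mod_mod_of_dvd _ (orderOf_dvd_of_pow_eq_one (rotMat_pow k)), pow_mod_orderOf]

/-- The group `Γ_k = ℤ² ⋊ ℤ/kℤ`. -/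
abbrev Gam (k : ℕ) : Type :=
  Multiplicative (Fin 2 → ℤ) ⋊[rotAct k] Multiplicative (ZMod k)

/-- The translation subgroup `Λ(Γ_k) = ℤ²` of `Γ_k`. -/
def transGroup (k : ℕ) : Subgroup (Gam k) :=
  (SemidirectProduct.inl : Multiplicative (Fin 2 → ℤ) →* Gam k).range

/-- The translation subgroup `Λ(Γ') = Γ' ∩ Λ(Γ_k)` of a subgroup `Γ'` of `Γ_k`. -/
def transPart {k : ℕ} (H : Subgroup (Gam k)) : Subgroup (Gam k) := H ⊓ transGroup k

/-- The rotations of `Γ_k` are the elements outside `Λ(Γ_k)`. -/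
def IsRotation {k : ℕ} (g : Gam k) : Prop := g ∉ transGroup k

open Classical in
/-- `T(Γ')` is `0` if `Γ'` contains a rotation, and `2` otherwise. -/
def T {k : ℕ} (H : Subgroup (Gam k)) : ℕ := if ∃ g ∈ H, IsRotation g then 0 else 2

/-! ### Representation spaces -/

/-- The Euclidean plane. -/
abbrev Plane : Type := EuclideanSpace ℝ (Fin 2)

/-- The group `Euc(2)` of isometries of the Euclidean plane, under composition. -/
abbrev Euc2 : Type := Plane ≃ᵃⁱ[ℝ] Plane

/-- The coordinates `Euc(2) ≅ ℝ² × O(2)`: an isometry is recorded by its value at the origin and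
its linear part. The topology of `Euc(2)` is the one induced by this injection. -/
def eucCoord (ψ : Euc2) : Plane × (Plane →L[ℝ] Plane) :=
  (ψ 0, (ψ.linearIsometryEquiv.toContinuousLinearEquiv : Plane →L[ℝ] Plane))

/-- `Rep(Γ)`: the discrete faithful representations of `Γ` in `Euc(2)`. -/
def Rep (Γ : Type*) [Group Γ] : Set (Γ →* Euc2) :=
  {Φ | Function.Injective Φ ∧ IsDiscrete (Set.range fun g => eucCoord (Φ g))}

/-- The restricted representation space `Rep_{Γ_k}(Γ')`: the representations of `Γ'` that extend
to a discrete faithful representation of `Γ_k`. -/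
def RepRes {k : ℕ} (H : Subgroup (Gam k)) : Set (H →* Euc2) :=
  {Φ | ∃ Ψ ∈ Rep (Gam k), Ψ.comp H.subtype = Φ}

/-- The dimension of a set `S` of representations of a group `H` in `Euc(2)`.
A representation is evaluated at a finite set `F` of elements of `H`, which identifies `S` (as soon
as `F` generates `H`) with a subset of a power of `Euc(2) ≅ ℝ² × O(2)`; the dimension is the
Hausdorff dimension of this subset, for `F` large enough. -/
def repSpaceDim {H : Type*} [Group H] (S : Set (H →* Euc2)) : ENNReal :=
  ⨆ F : Finset H, dimH ((fun (Φ : H →* Euc2) (g : F) => eucCoord (Φ g)) '' S)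

/-- `rep_{Γ_k}(Γ') = dim Rep_{Γ_k}(Γ')`. -/
def rep {k : ℕ} (H : Subgroup (Gam k)) : ℝ := (repSpaceDim (RepRes H)).toReal

/-! ### Colored graphs -/

/-- A directed multigraph (self-loops and multiple edges allowed) with vertex set `V` and edge set
`E`, and a color in `Γ` on every edge. -/
structure ColoredGraph (V E Γ : Type*) where
  tail : E → V
  head : E → V
  color : E → Γ

namespace ColoredGraph

variable {V E Γ : Type*}

/-- The (weakly) connected components. -/
def Component (G : ColoredGraph V E Γ) : Type _ :=
  Quot fun u v : V => ∃ e : E, G.tail e = u ∧ G.head e = v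

/-- The component of a vertex. -/
def component (G : ColoredGraph V E Γ) (v : V) : G.Component := Quot.mk _ v

/-- A base vertex in each connected component. -/
def base (G : ColoredGraph V E Γ) (c : G.Component) : V := Quot.out c

/-- Walks, which cross each edge either from tail to head or from head to tail. -/
inductive Walk (G : ColoredGraph V E Γ) : V → V → Type _
  | nil (v : V) : Walk G v v
  | fwd {u v w : V} (e : E) (hu : G.tail e = u) (hv : G.head e = v) (p : Walk G v w) : Walk G u w
  | bwd {u v w : V} (e : E) (hu : G.head e = u) (hv : G.tail e = v) (p : Walk G v w) : Walk G u w

namespace Walk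

variable {G : ColoredGraph V E Γ}

/-- The edges crossed by a walk, in order. -/
def edges {u v : V} : G.Walk u v → List E
  | nil _ => []
  | fwd e _ _ p => e :: p.edges
  | bwd e _ _ p => e :: p.edges

/-- The vertices at which the steps of a walk start, in order. -/
def starts {u v : V} : G.Walk u v → List V
  | nil _ => []
  | fwd (u := u) _ _ _ p => u :: p.starts
  | bwd (u := u) _ _ _ p => u :: p.starts

/-- The map `ρ`: the product of the colors along a walk, inverted for the edges that are
crossed from head to tail. -/
def rho [Group Γ] {u v : V} : G.Walk u v → Γ
  | nil _ => 1
  | fwd e _ _ p => G.color e * p.rho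
  | bwd e _ _ p => (G.color e)⁻¹ * p.rho

theorem exists_append [Group Γ] {u v w : V} (p : G.Walk u v) (q : G.Walk v w) :
    ∃ r : G.Walk u w, r.rho = p.rho * q.rho := by
  induction p with
  | nil v => exact ⟨q, by simp [rho]⟩
  | fwd e hu hv p ih =>
    obtain ⟨r, hr⟩ := ih q
    exact ⟨fwd e hu hv r, by simp [rho, hr, mul_assoc]⟩
  | bwd e hu hv p ih =>
    obtain ⟨r, hr⟩ := ih q
    exact ⟨bwd e hu hv r, by simp [rho, hr, mul_assoc]⟩

theorem exists_reverse [Group Γ] {u v : V} (p : G.Walk u v) :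
    ∃ r : G.Walk v u, r.rho = p.rho⁻¹ := by
  induction p with
  | nil v => exact ⟨nil v, by simp [rho]⟩
  | fwd e hu hv p ih =>
    obtain ⟨r, hr⟩ := ih
    obtain ⟨s, hs⟩ := exists_append r (bwd e hv hu (nil _))
    exact ⟨s, by simp [rho, hs, hr]⟩
  | bwd e hu hv p ih =>
    obtain ⟨r, hr⟩ := ih
    obtain ⟨s, hs⟩ := exists_append r (fwd e hv hu (nil _))
    exact ⟨s, by simp [rho, hs, hr]⟩

end Walk

/-- The image `ρ(π₁(G, b))`: the values of `ρ` on the closed walks at `b`. -/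
def rhoImage [Group Γ] (G : ColoredGraph V E Γ) (b : V) : Subgroup Γ where
  carrier := {g | ∃ p : G.Walk b b, p.rho = g}
  one_mem' := ⟨Walk.nil b, rfl⟩
  mul_mem' := by
    rintro _ _ ⟨p, rfl⟩ ⟨q, rfl⟩
    exact Walk.exists_append p q
  inv_mem' := by
    rintro _ ⟨p, rfl⟩
    exact Walk.exists_reverse p

/-- Subgraphs: a set of vertices and a set of edges with both endpoints among these vertices. -/
structure Subgraph (G : ColoredGraph V E Γ) where
  verts : Set V
  edges : Set E
  tail_mem : ∀ e ∈ edges, G.tail e ∈ verts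
  head_mem : ∀ e ∈ edges, G.head e ∈ verts

/-- A subgraph as a colored graph in its own right. -/
def Subgraph.toGraph {G : ColoredGraph V E Γ} (H : G.Subgraph) :
    ColoredGraph H.verts H.edges Γ where
  tail e := ⟨G.tail e, H.tail_mem e e.2⟩
  head e := ⟨G.head e, H.head_mem e e.2⟩
  color e := G.color e

/-- The spanning subgraph with edge set `F` (on all vertices of `G`). -/
def spanning (G : ColoredGraph V E Γ) (F : Set E) : ColoredGraph V F Γ where
  tail e := G.tail e
  head e := G.head e
  color e := G.color e

/-- A set of edges is a cycle if it is the set of edges crossed by a closed walk with at least one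
step that repeats neither an edge nor a vertex. A self-loop is a cycle, and so is a pair of
parallel edges. -/
def IsCycle (G : ColoredGraph V E Γ) (C : Set E) : Prop :=
  ∃ (v : V) (p : G.Walk v v), p.edges ≠ [] ∧ p.edges.Nodup ∧ p.starts.Nodup ∧
    C = {e | e ∈ p.edges}

/-- A map-graph: every connected component contains exactly one cycle. -/
def IsMapGraph (G : ColoredGraph V E Γ) : Prop :=
  ∀ c : G.Component, ∃! C : Set E, G.IsCycle C ∧ ∀ e ∈ C, G.component (G.tail e) = c

/-! ### `Γ`-(2,2) and `Γ`-(1,1) graphs -/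

variable {k : ℕ}

/-- `Λ(G, B)`: the subgroup generated by the translation subgroups of the `ρ(π₁(G_i, b_i))`. -/
def translations (G : ColoredGraph V E (Gam k)) : Subgroup (Gam k) :=
  ⨆ c : G.Component, transPart (G.rhoImage (G.base c))

/-- The sparsity function `f(G) = 2n + rep_{Γ_k}(G) - ∑ T(G_i)`. -/
def f (G : ColoredGraph V E (Gam k)) : ℝ :=
  2 * (Nat.card V : ℝ) + rep G.translations
    - ∑ᶠ c : G.Component, (T (G.rhoImage (G.base c)) : ℝ)

/-- `Γ`-(2,2) graphs. -/
def IsGamma22 (G : ColoredGraph V E (Gam k)) : Prop :=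
  (Nat.card E : ℝ) = 2 * (Nat.card V : ℝ) + rep (transGroup k) ∧
    ∀ H : G.Subgraph, (Nat.card H.edges : ℝ) ≤ H.toGraph.f

/-- `Γ`-(1,1) graphs: a (spanning) map-graph plus `rep_{Γ_k}(Λ(Γ_k)) / 2` additional edges, in
which the `ρ`-image of every connected component contains a rotation, and with
`rep_{Γ_k}(G) = rep_{Γ_k}(Λ(Γ_k))`. -/
def IsGamma11 (G : ColoredGraph V E (Gam k)) : Prop :=
  (∃ F : Set E, (G.spanning F).IsMapGraph ∧
      (Nat.card (Fᶜ : Set E) : ℝ) = rep (transGroup k) / 2) ∧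
    (∀ c : G.Component, ∃ g ∈ G.rhoImage (G.base c), IsRotation g) ∧
    rep G.translations = rep (transGroup k)

end ColoredGraph

end CrystRig

end

/-! Both sides of the equivalence are statements about one linear matroid. Give every vertex an
unknown position in `ℂ`, and let `Γ_k` act on `ℂ` through an unknown additive map `τ : ℤ² → ℂ` that
intertwines the matrix with the rotation by `2π/k`. Each edge imposes one equation, linear over `ℂ`:
the tail is the image of the head under the color. With `d` the complex dimension of the space of
such `τ`, there are `n + d` unknowns.

The key identity is that `f(G)` is twice the rank of this system (`f_eq`). On the representation
side, a discrete faithful representation sends translations to translations, with vectors given by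
an equivariant `τ` or its complex conjugate, and every equivariant `τ` whose image is a lattice
occurs. Hence, for a translation subgroup, `rep` is twice the codimension of the maps `τ` that
vanish on it (`rep_add_finrank_annihilator`). On the graph side, a `τ` extends to a solution exactly
when it vanishes on the translations of every component, and for `τ = 0` there is one free parameter
for each component without rotations (`finrank_solutions`). Subtracting from `n + d` gives `f / 2`.

Consequently a `Γ`-(2,2) graph is a system of `2(n + d)` edge forms in which every subset `F`
satisfies `|F| ≤ 2 rank F`. A `Γ`-(1,1) graph is a system whose edge forms are a basis of the dual
space; the map-graph that its definition asks for then exists automatically (`exists_isMapGraph`).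
The proposition becomes matroid partition into two bases (`exists_partition_of_card_le`), with
submodularity of rank for the converse. -/

noncomputable section

namespace CrystRig

/-! ### Isometries of the plane in complex coordinates -/

/-- The standard identification of `ℂ` with the Euclidean plane. -/
def toPlane : ℂ ≃ₗᵢ[ℝ] Plane := Complex.orthonormalBasisOneI.repr

/-- An isometry of the plane as a map `ℂ → ℂ`. -/
def complexForm (ψ : Euc2) (z : ℂ) : ℂ := toPlane.symm (ψ (toPlane z))

theorem complexForm_mul (ψ φ : Euc2) (z : ℂ) :
    complexForm (ψ * φ) z = complexForm ψ (complexForm φ z) := by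
  simp [complexForm]

theorem complexForm_one (z : ℂ) : complexForm 1 z = z := by
  simp [complexForm]

theorem norm_complexForm_zero (ψ : Euc2) : ‖complexForm ψ 0‖ = ‖ψ 0‖ := by
  simp [complexForm]

theorem norm_complexForm_sub (ψ : Euc2) (z w : ℂ) :
    ‖complexForm ψ z - complexForm ψ w‖ = ‖z - w‖ := by
  rw [complexForm, complexForm, ← map_sub, LinearIsometryEquiv.norm_map, ← dist_eq_norm,
    ψ.dist_map, toPlane.dist_map, dist_eq_norm]

theorem exists_complexForm_eq (ψ : Euc2) : ∃ a b : ℂ, ‖a‖ = 1 ∧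
    ((∀ z, complexForm ψ z = a * z + b) ∨
      ∀ z, complexForm ψ z = a * (starRingEnd ℂ) z + b) := by
  have key : ∀ z, complexForm ψ z =
      (toPlane.trans (ψ.linearIsometryEquiv.trans toPlane.symm)) z + complexForm ψ 0 := by
    intro z
    have h := ψ.map_vadd 0 (toPlane z)
    simp only [vadd_eq_add, add_zero] at h
    simp [complexForm, h]
  obtain ⟨a, h | h⟩ := linear_isometry_complex
    (toPlane.trans (ψ.linearIsometryEquiv.trans toPlane.symm))
  · refine ⟨(a : ℂ), complexForm ψ 0, Circle.norm_coe a, Or.inl fun z => ?_⟩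
    rw [key, h, rotation_apply]
  · refine ⟨(a : ℂ), complexForm ψ 0, Circle.norm_coe a, Or.inr fun z => ?_⟩
    rw [key, h]
    simp [rotation_apply]

/-! ### Discrete faithful representations -/

theorem eucCoord_injective : Function.Injective eucCoord := by
  intro ψ φ h
  simp only [eucCoord, Prod.mk.injEq] at h
  ext1 x
  have h1 := ψ.map_vadd 0 x
  have h2 := φ.map_vadd 0 x
  have h3 := DFunLike.congr_fun h.2 x
  simp only [vadd_eq_add, add_zero] at h1 h2
  rw [h1, h2, h.1]
  congr 1

/-- Left multiplication by an isometry preserves the distance in these coordinates, because its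
linear part preserves norms. This turns isolation of the identity into a uniform separation of the
whole group. -/
theorem dist_eucCoord_inv_mul (ψ φ : Euc2) :
    dist (eucCoord (ψ⁻¹ * φ)) (eucCoord 1) = dist (eucCoord φ) (eucCoord ψ) := by
  have e1 : dist ((ψ⁻¹ * φ) 0) ((1 : Euc2) 0) = dist (φ 0) (ψ 0) := by
    rw [← ψ.dist_map]
    simp
  have hl : ∀ x : Plane, ψ.linearIsometryEquiv ((ψ⁻¹ * φ).linearIsometryEquiv x) =
      φ.linearIsometryEquiv x := by
    intro x
    have hinv : ∀ y, ψ (ψ⁻¹ y) = y := ψ.apply_symm_apply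
    have h1 := (ψ⁻¹ * φ).map_vadd 0 x
    have h2 := φ.map_vadd 0 x
    have h3 := ψ.map_vadd ((ψ⁻¹ * φ) 0) ((ψ⁻¹ * φ).linearIsometryEquiv x)
    rw [← h1] at h3
    simp only [vadd_eq_add, add_zero, AffineIsometryEquiv.coe_mul, Function.comp_apply,
      hinv] at h2 h3
    rw [h2] at h3
    exact (add_right_cancel h3).symm
  have e2 : ‖(eucCoord (ψ⁻¹ * φ)).2 - (eucCoord 1).2‖ = ‖(eucCoord φ).2 - (eucCoord ψ).2‖ := by
    have : (eucCoord φ).2 - (eucCoord ψ).2 =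
        ψ.linearIsometryEquiv.toLinearIsometry.toContinuousLinearMap.comp
          ((eucCoord (ψ⁻¹ * φ)).2 - (eucCoord 1).2) := by
      ext1 x
      have := hl x
      simp only [eucCoord, ContinuousLinearMap.comp_apply, sub_apply]
      change _ = ψ.linearIsometryEquiv _
      rw [map_sub]
      change φ.linearIsometryEquiv x - ψ.linearIsometryEquiv x =
        ψ.linearIsometryEquiv ((ψ⁻¹ * φ).linearIsometryEquiv x) - ψ.linearIsometryEquiv x
      rw [this]
    rw [this, LinearIsometry.norm_toContinuousLinearMap_comp]
  rw [Prod.dist_eq, Prod.dist_eq, dist_eq_norm (eucCoord φ).2, ← e2, ← dist_eq_norm]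
  congr 1

/-- Discreteness upgrades to proper discontinuity: by left invariance the image is uniformly
separated, and the elements moving the origin by at most `C` form a bounded set since linear parts
have norm at most one. A closed bounded separated set in finite dimension is finite. -/
theorem Rep.finite_norm_le {Γ : Type*} [Group Γ] {Φ : Γ →* Euc2} (hΦ : Φ ∈ Rep Γ) (C : ℝ) :
    {g | ‖Φ g 0‖ ≤ C}.Finite := by
  obtain ⟨hinj, hdisc⟩ := hΦ
  have hinj' : Function.Injective fun g => eucCoord (Φ g) := eucCoord_injective.comp hinj
  obtain ⟨U, hU, hU1⟩ := isDiscrete_iff_forall_mem_exists_isOpen.1 hdisc (eucCoord (Φ 1))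
    ⟨1, rfl⟩
  have h1U : eucCoord (Φ 1) ∈ U := by
    have : eucCoord (Φ 1) ∈ U ∩ Set.range fun g => eucCoord (Φ g) := by rw [hU1]; rfl
    exact this.1
  obtain ⟨ε, hε, hball⟩ := Metric.isOpen_iff.1 hU _ h1U
  have hsep : ∀ g h : Γ, g ≠ h → ε ≤ dist (eucCoord (Φ g)) (eucCoord (Φ h)) := by
    intro g h hgh
    by_contra hlt
    rw [not_le, ← dist_eucCoord_inv_mul, ← map_inv, ← map_mul, ← map_one Φ] at hlt
    have hm : eucCoord (Φ (h⁻¹ * g)) ∈ U ∩ Set.range fun g => eucCoord (Φ g) :=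
      ⟨hball hlt, _, rfl⟩
    rw [hU1, Set.mem_singleton_iff] at hm
    have := hinj' hm
    exact hgh (inv_mul_eq_one.1 this).symm
  set A : Set (Plane × (Plane →L[ℝ] Plane)) := (fun g => eucCoord (Φ g)) '' {g | ‖Φ g 0‖ ≤ C}
  have hpair : A.Pairwise fun x y => ε ≤ dist x y := by
    rintro _ ⟨g, -, rfl⟩ _ ⟨h, -, rfl⟩ hne
    exact hsep g h fun e => hne (by rw [e])
  have hbdd : Bornology.IsBounded A := by
    refine (isBounded_iff_forall_norm_le).2 ⟨max C 1, ?_⟩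
    rintro _ ⟨g, hg, rfl⟩
    refine max_le_max hg ?_
    exact ContinuousLinearMap.opNorm_le_bound _ zero_le_one fun x => by
      rw [one_mul]
      exact ((Φ g).linearIsometryEquiv.norm_map x).le
  have hcomp : IsCompact A :=
    Metric.isCompact_of_isClosed_isBounded (Metric.isClosed_of_pairwise_le_dist hε hpair) hbdd
  have hfin : A.Finite := hcomp.finite ⟨DiscreteTopology.of_forall_le_dist hε fun x y hxy =>
    hpair x.2 y.2 fun h => hxy (Subtype.ext h)⟩
  exact hfin.of_finite_image hinj'.injOn

/-- A homomorphism from `ℤ²` to the line cannot be proper: each multiple of `a` can be brought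
within `|b|` of zero by a multiple of `b`. -/
theorem infinite_abs_le (a b : ℝ) : {t : Fin 2 → ℤ | |t 0 * a + t 1 * b| ≤ |b|}.Infinite := by
  by_cases hb : b = 0
  · subst hb
    refine Set.infinite_of_injective_forall_mem (f := fun n : ℤ => ![0, n]) ?_ (by simp)
    intro m n h
    simpa using congrFun h 1
  · refine Set.infinite_of_injective_forall_mem
      (f := fun n : ℤ => ![n, -⌊n * a / b⌋]) ?_ fun n => ?_
    · intro m n h
      simpa using congrFun h 0
    · have : (n : ℝ) * a + -(⌊n * a / b⌋ : ℝ) * b = Int.fract (n * a / b) * b := by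
        rw [Int.fract]; field_simp; ring
      simp only [Set.mem_ofPred_eq, Matrix.cons_val_zero, Matrix.cons_val_one, Int.cast_neg]
      rw [this, abs_mul, abs_of_nonneg (Int.fract_nonneg _)]
      exact mul_le_of_le_one_left (abs_nonneg _) (Int.fract_lt_one _).le

/-- A properly discontinuous action of `ℤ²` on the plane by isometries is by translations. -/
theorem exists_translation_of_finite {Φ : Multiplicative (Fin 2 → ℤ) →* Euc2}
    (hfin : ∀ C : ℝ, {g | ‖Φ g 0‖ ≤ C}.Finite) (g : Multiplicative (Fin 2 → ℤ)) :
    ∃ u : ℂ, ∀ z, complexForm (Φ g) z = z + u := by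
  have hcomm : ∀ g h z, complexForm (Φ g) (complexForm (Φ h) z) =
      complexForm (Φ h) (complexForm (Φ g) z) := by
    intro g h z
    rw [← complexForm_mul, ← complexForm_mul, ← map_mul, mul_comm, map_mul]
  have hinf : (Set.univ : Set (Multiplicative (Fin 2 → ℤ))).Infinite := by
    have : Infinite (Multiplicative (Fin 2 → ℤ)) :=
      inferInstanceAs (Infinite (Fin 2 → ℤ))
    exact Set.infinite_univ
  -- A nontrivial rotation has a unique fixed point, which every commuting isometry also fixes. Then
  -- the orbit of the origin is bounded, against `hfin`.
  have hrot : ∀ g a b, (∀ z, complexForm (Φ g) z = a * z + b) → a = 1 := by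
    intro g a b hg
    by_contra ha
    have ha' : 1 - a ≠ 0 := fun h => ha (sub_eq_zero.1 h).symm
    have huniq : ∀ y, a * y + b = y ↔ y = b / (1 - a) := by
      intro y
      rw [eq_div_iff ha']
      constructor <;> intro h <;> linear_combination -h
    have hfix : ∀ h, complexForm (Φ h) (b / (1 - a)) = b / (1 - a) := by
      intro h
      rw [← huniq, ← hg, hcomm, hg, (huniq _).2 rfl]
    refine hinf ((hfin (2 * ‖b / (1 - a)‖)).subset fun h _ => ?_)
    have h1 := norm_complexForm_sub (Φ h) 0 (b / (1 - a))
    rw [hfix, zero_sub, norm_neg] at h1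
    have h2 := norm_sub_norm_le (complexForm (Φ h) 0) (b / (1 - a))
    rw [norm_complexForm_zero] at h2
    simp only [Set.mem_ofPred_eq]
    linarith
  have hsq : ∀ h, ∃ u : ℂ, ∀ z, complexForm (Φ (h * h)) z = z + u := by
    intro h
    obtain ⟨a, b, ha, hz | hz⟩ := exists_complexForm_eq (Φ h)
    · have := hrot h a b hz
      subst this
      exact ⟨b + b, fun z => by rw [map_mul, complexForm_mul, hz, hz]; ring⟩
    · refine ⟨a * (starRingEnd ℂ) b + b, fun z => ?_⟩
      have ha' : a * (starRingEnd ℂ) a = 1 := by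
        rw [Complex.mul_conj, Complex.normSq_eq_norm_sq, ha]; simp
      rw [map_mul, complexForm_mul, hz, hz, map_add, map_mul, Complex.conj_conj]
      linear_combination z * ha'
  obtain ⟨a, b, ha, hz | hz⟩ := exists_complexForm_eq (Φ g)
  · have := hrot g a b hz
    subst this
    exact ⟨b, fun z => by rw [hz, one_mul]⟩
  -- Now `g` reverses orientation. All squares are translations commuting with it, so their vectors
  -- lie on one real line, which division by a square root `c` of `a` makes the real axis. This is a
  -- homomorphism from `ℤ²` to `ℝ`, which cannot be proper.
  exfalso
  choose u hu using hsq
  have hu_add : ∀ s t, u (s * t) = u s + u t := by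
    intro s t
    have h1 := hu (s * t) 0
    rw [mul_mul_mul_comm, map_mul, complexForm_mul, hu, hu] at h1
    linear_combination -h1
  have hu_line : ∀ s, a * (starRingEnd ℂ) (u s) = u s := by
    intro s
    have h1 := hcomm g (s * s) 0
    rw [hu, hu, hz, hz] at h1
    simp only [zero_add, map_zero, mul_zero] at h1
    linear_combination h1
  obtain ⟨c, hc⟩ := IsAlgClosed.exists_pow_nat_eq a (n := 2) (by norm_num)
  have hc1 : ‖c‖ = 1 := by
    have : ‖c‖ ^ 2 = 1 := by rw [← norm_pow, hc, ha]
    exact (pow_eq_one_iff_of_nonneg (norm_nonneg c) two_ne_zero).1 this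
  have hcc : c * (starRingEnd ℂ) c = 1 := by
    rw [Complex.mul_conj, Complex.normSq_eq_norm_sq, hc1]; simp
  let r : Multiplicative (Fin 2 → ℤ) →* Multiplicative ℝ :=
    { toFun := fun s => Multiplicative.ofAdd (u s * (starRingEnd ℂ) c).re
      map_one' := by
        have := hu_add 1 1
        simp only [mul_one] at this
        have h0 : u 1 = 0 := by linear_combination -this
        simp [h0]
      map_mul' := fun s t => by
        rw [hu_add, add_mul, Complex.add_re, ofAdd_add] }
  have hru : ∀ s, ‖u s‖ = |(u s * (starRingEnd ℂ) c).re| := by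
    intro s
    have hreal : (starRingEnd ℂ) (u s * (starRingEnd ℂ) c) = u s * (starRingEnd ℂ) c := by
      have h1 := hu_line s
      rw [map_mul, Complex.conj_conj]
      rw [← hc] at h1
      calc (starRingEnd ℂ) (u s) * c = (starRingEnd ℂ) (u s) * c * (c * (starRingEnd ℂ) c) := by
            rw [hcc, mul_one]
        _ = _ := by linear_combination (starRingEnd ℂ) c * h1
    have h2 := Complex.conj_eq_iff_real.1 hreal
    obtain ⟨x, hx⟩ := h2
    calc ‖u s‖ = ‖u s * (starRingEnd ℂ) c‖ := by
          rw [norm_mul, RCLike.norm_conj, hc1, mul_one]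
      _ = _ := by rw [hx]; simp
  have hr : ∀ t : Fin 2 → ℤ, (u (Multiplicative.ofAdd t) * (starRingEnd ℂ) c).re =
      t 0 * (r (Multiplicative.ofAdd (Pi.single 0 1))).toAdd +
        t 1 * (r (Multiplicative.ofAdd (Pi.single 1 1))).toAdd := by
    intro t
    have ht : t = t 0 • Pi.single 0 1 + t 1 • Pi.single 1 1 := by
      ext i; fin_cases i <;> simp
    have h1 : r (Multiplicative.ofAdd t) = Multiplicative.ofAdd
      (u (Multiplicative.ofAdd t) * (starRingEnd ℂ) c).re := rfl
    rw [← toAdd_ofAdd (u (Multiplicative.ofAdd t) * (starRingEnd ℂ) c).re, ← h1]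
    conv_lhs => rw [ht]
    rw [ofAdd_add, ofAdd_zsmul, ofAdd_zsmul, map_mul, map_zpow, map_zpow, toAdd_mul, toAdd_zpow,
      toAdd_zpow, zsmul_eq_mul, zsmul_eq_mul]
  have hf := hfin |(r (Multiplicative.ofAdd (Pi.single 1 1))).toAdd|
  have hf2 := hf.preimage (f := fun t : Fin 2 → ℤ => Multiplicative.ofAdd t * Multiplicative.ofAdd t)
    (by
      intro s _ t _ hst
      have h1 : s + s = t + t := hst
      funext i
      have := congrFun h1 i
      simp only [Pi.add_apply] at this
      omega)
  refine infinite_abs_le (r (Multiplicative.ofAdd (Pi.single 0 1))).toAdd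
    (r (Multiplicative.ofAdd (Pi.single 1 1))).toAdd (hf2.subset ?_)
  intro t ht
  simp only [Set.mem_preimage, Set.mem_ofPred_eq] at ht ⊢
  rw [← norm_complexForm_zero, hu, zero_add, hru, hr]
  exact ht

/-! ### Equivariant maps `ℤ² → ℂ` -/

/-- The rotation by the angle `2π/k`. -/
def zeta (k : ℕ) : Circle := Circle.exp (2 * Real.pi / k)

theorem zeta_isPrimitiveRoot {k : ℕ} (hk : k ≠ 0) : IsPrimitiveRoot (zeta k : ℂ) k := by
  have : (zeta k : ℂ) = Complex.exp (2 * Real.pi * Complex.I / k) := by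
    rw [zeta, Circle.coe_exp]
    congr 1
    push_cast
    ring
  rw [this]
  exact Complex.isPrimitiveRoot_exp k hk

theorem zeta_pow (k : ℕ) : zeta k ^ k = 1 := by
  rcases eq_or_ne k 0 with rfl | hk
  · simp
  · ext
    simpa using (zeta_isPrimitiveRoot hk).pow_eq_one

/-- The character of `ℤ/kℤ` by which the generator acts as a rotation by `2π/k`. -/
def rotChar (k : ℕ) : Multiplicative (ZMod k) →* Circle where
  toFun r := zeta k ^ r.toAdd.val
  map_one' := by simp
  map_mul' r s := by
    rw [← pow_add]
    rcases Nat.eq_zero_or_pos k with rfl | hk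
    · have h : zeta 0 = 1 := by simp [zeta]
      simp [h]
    · have : NeZero k := ⟨hk.ne'⟩
      rw [toAdd_mul, ZMod.val_add, ← pow_mod_orderOf,
        Nat.mod_mod_of_dvd _ (orderOf_dvd_of_pow_eq_one (zeta_pow k)), pow_mod_orderOf]

theorem rotChar_injective {k : ℕ} (hk : k ≠ 0) : Function.Injective (rotChar k) := by
  intro r s h
  have : NeZero k := ⟨hk⟩
  have h' : (zeta k : ℂ) ^ r.toAdd.val = (zeta k : ℂ) ^ s.toAdd.val := by
    have h0 : zeta k ^ r.toAdd.val = zeta k ^ s.toAdd.val := h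
    rw [← Circle.coe_pow, h0, Circle.coe_pow]
  have := (zeta_isPrimitiveRoot hk).pow_inj (ZMod.val_lt _) (ZMod.val_lt _) h'
  exact Multiplicative.toAdd.injective (ZMod.val_injective k this)

/-- The additive map `ℤ² → ℂ` with given values on the standard basis. -/
def latticeMap (τ : Fin 2 → ℂ) (t : Multiplicative (Fin 2 → ℤ)) : ℂ :=
  t.toAdd 0 * τ 0 + t.toAdd 1 * τ 1

theorem latticeMap_mul (τ : Fin 2 → ℂ) (s t : Multiplicative (Fin 2 → ℤ)) :
    latticeMap τ (s * t) = latticeMap τ s + latticeMap τ t := by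
  simp [latticeMap]
  ring

theorem latticeMap_one (τ : Fin 2 → ℂ) : latticeMap τ 1 = 0 := by
  simp [latticeMap]

theorem latticeMap_add (σ τ : Fin 2 → ℂ) (t : Multiplicative (Fin 2 → ℤ)) :
    latticeMap (σ + τ) t = latticeMap σ t + latticeMap τ t := by
  simp [latticeMap]
  ring

theorem latticeMap_smul (c : ℂ) (τ : Fin 2 → ℂ) (t : Multiplicative (Fin 2 → ℤ)) :
    latticeMap (c • τ) t = c * latticeMap τ t := by
  simp [latticeMap]
  ring

/-- `rotMatrix k` as an automorphism of the multiplicative group `ℤ²`. -/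
def rotEnd (k : ℕ) : MulAut (Multiplicative (Fin 2 → ℤ)) := slAct (rotMat k)

theorem toAdd_rotEnd (k : ℕ) (t : Multiplicative (Fin 2 → ℤ)) :
    (rotEnd k t).toAdd = (rotMatrix k).mulVec t.toAdd := rfl

theorem rotAct_eq_pow (k : ℕ) (r : Multiplicative (ZMod k)) :
    rotAct k r = rotEnd k ^ r.toAdd.val := by
  rw [rotEnd, ← map_pow]
  rfl

/-- The additive maps `ℤ² → ℂ` that intertwine `rotMatrix k` and the rotation by `2π/k`. -/
def equivariantMaps (k : ℕ) : Submodule ℂ (Fin 2 → ℂ) where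
  carrier := {τ | ∀ t, latticeMap τ (rotEnd k t) = zeta k * latticeMap τ t}
  add_mem' hσ hτ t := by
    rw [latticeMap_add, latticeMap_add, hσ, hτ, mul_add]
  zero_mem' t := by simp [latticeMap]
  smul_mem' c τ hτ t := by
    rw [latticeMap_smul, latticeMap_smul, hτ]
    ring

theorem mem_equivariantMaps {k : ℕ} {τ : Fin 2 → ℂ} : τ ∈ equivariantMaps k ↔
    ∀ t, latticeMap τ (rotEnd k t) = zeta k * latticeMap τ t := Iff.rfl

theorem latticeMap_rotAct {k : ℕ} {τ : Fin 2 → ℂ} (hτ : τ ∈ equivariantMaps k)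
    (r : Multiplicative (ZMod k)) (t : Multiplicative (Fin 2 → ℤ)) :
    latticeMap τ (rotAct k r t) = rotChar k r * latticeMap τ t := by
  have key : ∀ n : ℕ, latticeMap τ ((rotEnd k ^ n) t) = (zeta k : ℂ) ^ n * latticeMap τ t := by
    intro n
    induction n with
    | zero => simp
    | succ n ih =>
      rw [pow_succ', MulAut.mul_apply, mem_equivariantMaps.1 hτ, ih, pow_succ']
      ring
  rw [rotAct_eq_pow, key]
  simp [rotChar]

theorem zeta_two : (zeta 2 : ℂ) = -1 := (zeta_isPrimitiveRoot two_ne_zero).eq_neg_one_of_two_right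

/-- In these cases the matrix is the companion matrix of the cyclotomic polynomial `X² - cX + 1`.
The exclusion of `-2` permits a division by `c + 2` in `Rep.exists_equivariantMaps`. -/
theorem exists_trace {k : ℕ} (hk : k = 3 ∨ k = 4 ∨ k = 6) : ∃ c : ℤ, c ≠ -2 ∧
    rotMatrix k = !![0, -1; 1, c] ∧ (zeta k : ℂ) ^ 2 - c * zeta k + 1 = 0 := by
  rcases hk with rfl | rfl | rfl
  · refine ⟨-1, by norm_num, by simp [rotMatrix], ?_⟩
    have h := zeta_isPrimitiveRoot (k := 3) (by norm_num)
    have h1 : (zeta 3 : ℂ) - 1 ≠ 0 := sub_ne_zero.2 (h.ne_one (by norm_num))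
    apply mul_left_cancel₀ h1
    push_cast
    linear_combination h.pow_eq_one
  · refine ⟨0, by norm_num, by simp [rotMatrix], ?_⟩
    have h := zeta_isPrimitiveRoot (k := 4) (by norm_num)
    have h1 : (zeta 4 : ℂ) ^ 2 - 1 ≠ 0 :=
      sub_ne_zero.2 (h.pow_ne_one_of_pos_of_lt (by norm_num) (by norm_num))
    apply mul_left_cancel₀ h1
    push_cast
    linear_combination h.pow_eq_one
  · refine ⟨1, by norm_num, by simp [rotMatrix], ?_⟩
    have h := zeta_isPrimitiveRoot (k := 6) (by norm_num)
    have h1 : (zeta 6 : ℂ) ^ 3 - 1 ≠ 0 :=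
      sub_ne_zero.2 (h.pow_ne_one_of_pos_of_lt (by norm_num) (by norm_num))
    have h2 : (zeta 6 : ℂ) + 1 ≠ 0 := by
      intro h2
      have h3 : (zeta 6 : ℂ) ^ 2 - 1 ≠ 0 :=
        sub_ne_zero.2 (h.pow_ne_one_of_pos_of_lt (by norm_num) (by norm_num))
      exact h3 (by linear_combination (zeta 6 - 1 : ℂ) * h2)
    apply mul_left_cancel₀ (mul_ne_zero h1 h2)
    push_cast
    linear_combination h.pow_eq_one

theorem equivariantMaps_two : equivariantMaps 2 = ⊤ := by
  refine eq_top_iff.2 fun τ _ t => ?_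
  simp only [latticeMap, toAdd_rotEnd, rotMatrix, if_true, Matrix.mulVec, dotProduct,
    Fin.sum_univ_two, Matrix.of_apply, Matrix.cons_val_zero, Matrix.cons_val_one, zeta_two]
  push_cast
  ring

theorem mem_equivariantMaps_of_eq {k : ℕ} (hk : k = 3 ∨ k = 4 ∨ k = 6) {τ : Fin 2 → ℂ}
    (h : τ 1 = zeta k * τ 0) : τ ∈ equivariantMaps k := by
  obtain ⟨c, -, hR, hz⟩ := exists_trace hk
  intro t
  simp only [latticeMap, toAdd_rotEnd, hR, Matrix.mulVec, dotProduct, Fin.sum_univ_two,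
    Matrix.of_apply, Matrix.cons_val_zero, Matrix.cons_val_one, h]
  push_cast
  linear_combination -(t.toAdd 1 : ℂ) * τ 0 * hz

/-- The maps `ℤ² → ℂ` whose image is a lattice. -/
def latticeForms (k : ℕ) : Set (equivariantMaps k) :=
  {τ | ((starRingEnd ℂ) (τ.1 0) * τ.1 1).im ≠ 0}

theorem isOpen_latticeForms (k : ℕ) : IsOpen (latticeForms k) := by
  refine isOpen_ne_fun ?_ continuous_const
  have : ∀ i, Continuous fun τ : equivariantMaps k => τ.1 i := fun i =>
    (continuous_apply i).comp continuous_subtype_val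
  exact Complex.continuous_im.comp ((Complex.continuous_conj.comp (this 0)).mul (this 1))

theorem latticeForms_nonempty {k : ℕ} (hk : k = 2 ∨ k = 3 ∨ k = 4 ∨ k = 6) :
    (latticeForms k).Nonempty := by
  rcases hk with rfl | hk
  · exact ⟨⟨![1, Complex.I], by rw [equivariantMaps_two]; trivial⟩, by simp [latticeForms]⟩
  · refine ⟨⟨![1, zeta k], mem_equivariantMaps_of_eq hk (by simp)⟩, ?_⟩
    simp only [latticeForms, Set.mem_ofPred_eq, Matrix.cons_val_zero, map_one, one_mul,
      Matrix.cons_val_one]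
    intro him
    have hre : (zeta k : ℂ) = ((zeta k : ℂ).re : ℂ) := Complex.ext (by simp) (by simpa using him)
    have hn : ‖(zeta k : ℂ)‖ = 1 := Circle.norm_coe _
    rw [hre, Complex.norm_real, Real.norm_eq_abs] at hn
    have hsq : (zeta k : ℂ) ^ 2 = 1 := by
      rw [hre, ← Complex.ofReal_pow, ← sq_abs, hn]
      simp
    have h := zeta_isPrimitiveRoot (k := k) (by omega)
    exact h.pow_ne_one_of_pos_of_lt two_ne_zero (by omega) hsq

/-! ### Restrictions of discrete faithful representations to translations -/

theorem complexForm_injective : Function.Injective complexForm := by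
  intro ψ φ h
  ext1 x
  have := congrFun h (toPlane.symm x)
  simpa [complexForm] using this

theorem eucCoord_of_complexForm {ψ : Euc2} {u : ℂ} (h : ∀ z, complexForm ψ z = z + u) :
    eucCoord ψ = (toPlane u, ContinuousLinearMap.id ℝ Plane) := by
  have h' : ∀ x, ψ x = x + toPlane u := by
    intro x
    have := h (toPlane.symm x)
    rw [complexForm, LinearIsometryEquiv.apply_symm_apply, LinearIsometryEquiv.symm_apply_eq,
      map_add, LinearIsometryEquiv.apply_symm_apply] at this
    exact this
  refine Prod.ext (by simp [eucCoord, h']) ?_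
  ext1 x
  have h2 := ψ.map_vadd 0 x
  simp only [vadd_eq_add, add_zero, h', zero_add] at h2
  exact (add_right_cancel h2).symm

/-- The rotation by `a` followed by the translation by `b`. -/
def planeIsometry (a : Circle) (b : ℂ) : Euc2 :=
  AffineIsometryEquiv.constVAdd ℝ Plane (toPlane b) *
    (toPlane.symm.trans ((rotation a).trans toPlane)).toAffineIsometryEquiv

theorem complexForm_planeIsometry (a : Circle) (b z : ℂ) :
    complexForm (planeIsometry a b) z = a * z + b := by
  simp [complexForm, planeIsometry, rotation_apply, add_comm]

/-- The representation of `Γ_k` by rotations and translations given by an equivariant map. -/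
def latticeRep {k : ℕ} (τ : equivariantMaps k) : Gam k →* Euc2 where
  toFun g := planeIsometry (rotChar k g.right) (latticeMap τ g.left)
  map_one' := by
    apply complexForm_injective
    ext z
    simp [complexForm_planeIsometry, complexForm_one, latticeMap_one]
  map_mul' g h := by
    apply complexForm_injective
    ext z
    rw [complexForm_mul, complexForm_planeIsometry, complexForm_planeIsometry,
      complexForm_planeIsometry, SemidirectProduct.mul_left, SemidirectProduct.mul_right,
      latticeMap_mul, latticeMap_rotAct τ.2, map_mul, Circle.coe_mul]
    ring

theorem complexForm_latticeRep {k : ℕ} (τ : equivariantMaps k) (g : Gam k) (z : ℂ) :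
    complexForm (latticeRep τ g) z = rotChar k g.right * z + latticeMap τ g.left :=
  complexForm_planeIsometry _ _ _

theorem latticeRep_mem_Rep {k : ℕ} (hk : k ≠ 0) {τ : equivariantMaps k}
    (hτ : τ ∈ latticeForms k) : latticeRep τ ∈ Rep (Gam k) := by
  set D := ((starRingEnd ℂ) (τ.1 0) * τ.1 1).im with hD
  have hD0 : 0 < |D| := abs_pos.2 hτ
  have : NeZero k := ⟨hk⟩
  -- By Cramer's rule `p` and `q` recover `D` times the two integer coordinates of the translation
  -- part, while `s` recovers the rotation. Being continuous, they isolate each image point.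
  let p : Plane × (Plane →L[ℝ] Plane) → ℝ := fun x =>
    ((starRingEnd ℂ) (toPlane.symm x.1) * τ.1 1).im
  let q : Plane × (Plane →L[ℝ] Plane) → ℝ := fun x =>
    ((starRingEnd ℂ) (τ.1 0) * toPlane.symm x.1).im
  let s : Plane × (Plane →L[ℝ] Plane) → ℂ := fun x => toPlane.symm (x.2 (toPlane 1))
  have hp : Continuous p := Complex.continuous_im.comp
    ((Complex.continuous_conj.comp (toPlane.symm.continuous.comp continuous_fst)).mul
      continuous_const)
  have hq : Continuous q := Complex.continuous_im.comp
    (continuous_const.mul (toPlane.symm.continuous.comp continuous_fst))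
  have hs : Continuous s := toPlane.symm.continuous.comp
    (continuous_snd.clm_apply continuous_const)
  have h1 : ∀ g, toPlane.symm (eucCoord (latticeRep τ g)).1 = latticeMap τ g.left := by
    intro g
    have := complexForm_latticeRep τ g 0
    simpa [complexForm, eucCoord] using this
  have hpg : ∀ g, p (eucCoord (latticeRep τ g)) = g.left.toAdd 0 * D := by
    intro g
    simp only [p, h1, latticeMap, hD]
    simp
    ring
  have hqg : ∀ g, q (eucCoord (latticeRep τ g)) = g.left.toAdd 1 * D := by
    intro g
    simp only [q, h1, latticeMap, hD]
    simp
    ring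
  have hsg : ∀ g, s (eucCoord (latticeRep τ g)) = rotChar k g.right := by
    intro g
    have e1 := complexForm_latticeRep τ g 1
    have e2 := complexForm_latticeRep τ g 0
    have e3 := (latticeRep τ g).map_vadd 0 (toPlane 1)
    simp only [vadd_eq_add, add_zero] at e3
    simp only [complexForm, map_zero] at e1 e2
    rw [e3, map_add, e2] at e1
    simp only [mul_one, mul_zero, zero_add, add_left_inj] at e1
    exact e1
  have hsep : ∀ g h : Gam k, |p (eucCoord (latticeRep τ g)) - p (eucCoord (latticeRep τ h))| < |D| →
      |q (eucCoord (latticeRep τ g)) - q (eucCoord (latticeRep τ h))| < |D| →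
      s (eucCoord (latticeRep τ g)) = s (eucCoord (latticeRep τ h)) → g = h := by
    intro g h e1 e2 e3
    rw [hpg, hpg, ← sub_mul, abs_mul, mul_lt_iff_lt_one_left hD0, ← Int.cast_sub, ← Int.cast_abs]
      at e1
    rw [hqg, hqg, ← sub_mul, abs_mul, mul_lt_iff_lt_one_left hD0, ← Int.cast_sub, ← Int.cast_abs]
      at e2
    rw [hsg, hsg] at e3
    have e1' : |g.left.toAdd 0 - h.left.toAdd 0| < 1 := by exact_mod_cast e1
    have e2' : |g.left.toAdd 1 - h.left.toAdd 1| < 1 := by exact_mod_cast e2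
    refine SemidirectProduct.ext ?_ (rotChar_injective hk (Circle.ext e3))
    apply Multiplicative.toAdd.injective
    funext i
    rw [Int.abs_lt_one_iff, sub_eq_zero] at e1' e2'
    fin_cases i
    · exact e1'
    · exact e2'
  refine ⟨fun g h hgh => hsep g h ?_ ?_ ?_, isDiscrete_iff_forall_mem_exists_isOpen.2 ?_⟩
  · simpa [hgh] using hD0
  · simpa [hgh] using hD0
  · rw [hgh]
  rintro _ ⟨h, rfl⟩
  refine ⟨{x | |p x - p (eucCoord (latticeRep τ h))| < |D|} ∩
    ({x | |q x - q (eucCoord (latticeRep τ h))| < |D|} ∩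
      s ⁻¹' ((fun r => (rotChar k r : ℂ)) '' {r | r ≠ h.right})ᶜ), ?_, ?_⟩
  · refine (isOpen_lt (hp.sub continuous_const).abs continuous_const).inter
      ((isOpen_lt (hq.sub continuous_const).abs continuous_const).inter ?_)
    have hfin : Finite (Multiplicative (ZMod k)) := inferInstanceAs (Finite (ZMod k))
    exact ((Set.toFinite _).isClosed.isOpen_compl).preimage hs
  · ext x
    constructor
    · rintro ⟨⟨h1, h2, h3⟩, g, rfl⟩
      have : g = h := by
        refine hsep g h h1 h2 ?_
        rw [hsg, hsg]
        by_contra hne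
        exact h3 ⟨g.right, fun e => hne (by rw [e]), (hsg g).symm⟩
      rw [this]
      rfl
    · rintro rfl
      refine ⟨⟨by simpa using hD0, by simpa using hD0, ?_⟩, h, rfl⟩
      rintro ⟨r, hr, hr'⟩
      refine hr (rotChar_injective hk (Circle.ext ?_))
      have := hsg h
      exact hr'.trans this

/-- Conjugation by the generator of `ℤ/kℤ` preserves the length of translation vectors, so the
matrix preserves a quadratic form on `ℤ²`. For `k = 3, 4, 6` this forces the ratio of the two basis
vectors to be `zeta k` or its conjugate, according to orientation; for `k = 2` there is no
constraint. -/
theorem Rep.exists_equivariantMaps {k : ℕ} (hk : k = 2 ∨ k = 3 ∨ k = 4 ∨ k = 6)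
    {Ψ : Gam k →* Euc2} (hΨ : Ψ ∈ Rep (Gam k)) : ∃ τ ∈ equivariantMaps k,
    (∀ t z, complexForm (Ψ (SemidirectProduct.inl t)) z = z + latticeMap τ t) ∨
    (∀ t z, complexForm (Ψ (SemidirectProduct.inl t)) z =
      z + (starRingEnd ℂ) (latticeMap τ t)) := by
  have htrans := exists_translation_of_finite (Φ := Ψ.comp SemidirectProduct.inl) fun C =>
    (Rep.finite_norm_le hΨ C).preimage SemidirectProduct.inl_injective.injOn
  choose u hu using htrans
  simp only [MonoidHom.comp_apply] at hu
  have hu_mul : ∀ s t, u (s * t) = u s + u t := by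
    intro s t
    have h := hu (s * t) 0
    rw [map_mul, map_mul, complexForm_mul, hu, hu] at h
    linear_combination -h
  have hτ : ∀ t, u t = latticeMap (fun i => u (Multiplicative.ofAdd (Pi.single i 1))) t := by
    let U : Multiplicative (Fin 2 → ℤ) →* Multiplicative ℂ :=
      MonoidHom.mk' (fun t => Multiplicative.ofAdd (u t)) fun s t => by rw [hu_mul, ofAdd_add]
    intro t
    have ht : t = Multiplicative.ofAdd (Pi.single 0 1) ^ t.toAdd 0 *
        Multiplicative.ofAdd (Pi.single 1 1) ^ t.toAdd 1 := by
      apply Multiplicative.toAdd.injective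
      ext i; fin_cases i <;> simp
    have h1 : u t = (U t).toAdd := rfl
    rw [h1, ht, map_mul, map_zpow, map_zpow, toAdd_mul, toAdd_zpow, toAdd_zpow, zsmul_eq_mul,
      zsmul_eq_mul, ← ht]
    rfl
  have hnorm : ∀ t, ‖u (rotEnd k t)‖ = ‖u t‖ := by
    intro t
    have hk1 : (Multiplicative.ofAdd (1 : ZMod k)).toAdd.val = 1 := by
      have : Fact (1 < k) := ⟨by omega⟩
      exact ZMod.val_one k
    have h1 : (SemidirectProduct.inl (rotEnd k t) : Gam k) *
        SemidirectProduct.inr (Multiplicative.ofAdd (1 : ZMod k)) =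
        SemidirectProduct.inr (Multiplicative.ofAdd (1 : ZMod k)) * SemidirectProduct.inl t := by
      have h2 := SemidirectProduct.inl_aut (φ := rotAct k) (Multiplicative.ofAdd (1 : ZMod k)) t
      rw [rotAct_eq_pow, hk1, pow_one] at h2
      rw [h2, map_inv, inv_mul_cancel_right]
    have h3 := congrArg (fun g => complexForm (Ψ g) 0) h1
    simp only [map_mul, complexForm_mul, hu, zero_add] at h3
    have h4 := norm_complexForm_sub (Ψ (SemidirectProduct.inr (Multiplicative.ofAdd (1 : ZMod k))))
      (u t) 0
    rw [← h3, add_sub_cancel_left, sub_zero] at h4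
    exact h4
  set τ : Fin 2 → ℂ := fun i => u (Multiplicative.ofAdd (Pi.single i 1)) with hτdef
  rcases hk with rfl | hk
  · exact ⟨τ, by rw [equivariantMaps_two]; trivial, Or.inl fun t z => by rw [hu, hτ]⟩
  obtain ⟨c, hc2, hR, hz⟩ := exists_trace hk
  have hτ0 : τ 0 ≠ 0 := by
    intro h0
    have h1 : Ψ (SemidirectProduct.inl (Multiplicative.ofAdd (Pi.single 0 1))) = 1 := by
      apply complexForm_injective
      ext z
      rw [hu, complexForm_one]
      exact (congrArg (z + ·) h0).trans (add_zero z)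
    have h2 := hΨ.1 (h1.trans (map_one Ψ).symm)
    have h3 := congrFun (congrArg Multiplicative.toAdd
      (SemidirectProduct.inl_injective (h2.trans (map_one SemidirectProduct.inl).symm))) 0
    simp at h3
  have hn : ∀ x y : ℤ, Complex.normSq (-y * τ 0 + (x + c * y) * τ 1) =
      Complex.normSq (x * τ 0 + y * τ 1) := by
    intro x y
    have h1 := hnorm (Multiplicative.ofAdd ![x, y])
    rw [hτ, hτ] at h1
    simp only [latticeMap, toAdd_rotEnd, hR, Matrix.mulVec, dotProduct, Fin.sum_univ_two,
      Matrix.of_apply, Matrix.cons_val_zero, Matrix.cons_val_one, toAdd_ofAdd] at h1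
    rw [Complex.normSq_eq_norm_sq, Complex.normSq_eq_norm_sq, ← h1]
    congr 2
    push_cast
    ring
  obtain ⟨a, ha⟩ : ∃ a, τ 1 = a * τ 0 := ⟨τ 1 / τ 0, (div_mul_cancel₀ _ hτ0).symm⟩
  have hN : Complex.normSq (τ 0) ≠ 0 := by simpa using hτ0
  have hn' : ∀ x y : ℤ, Complex.normSq (-y + (x + c * y) * a) = Complex.normSq (x + y * a) := by
    intro x y
    have h1 := hn x y
    rw [ha] at h1
    have e1 : -(y : ℂ) * τ 0 + (x + c * y) * (a * τ 0) = (-y + (x + c * y) * a) * τ 0 := by ring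
    have e2 : (x : ℂ) * τ 0 + y * (a * τ 0) = (x + y * a) * τ 0 := by ring
    rw [e1, e2, Complex.normSq_mul, Complex.normSq_mul] at h1
    exact mul_right_cancel₀ hN h1
  -- Invariance at `(1, 0)` gives `|a| = 1`, and at `(1, 1)` it then gives `2 Re a = c`. So `a` is a
  -- root of `X² - cX + 1`.
  have h10 := hn' 1 0
  have h11 := hn' 1 1
  simp only [Complex.normSq_apply, Int.cast_zero, Int.cast_one] at h10 h11
  simp at h10 h11
  have hc2' : (c : ℝ) + 2 ≠ 0 := by
    intro h
    apply hc2
    have : ((c + 2 : ℤ) : ℝ) = 0 := by push_cast; exact h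
    have := Int.cast_eq_zero.1 this
    omega
  have hre : 2 * a.re = c := by
    apply mul_left_cancel₀ hc2'
    linear_combination -h11 + ((1 + (c : ℝ)) ^ 2 - 1) * h10
  have haa : a ^ 2 - c * a + 1 = 0 := by
    rw [Complex.ext_iff]
    simp [pow_two]
    constructor
    · linear_combination -a.re * hre - h10 + 2 * a.re * hre
    · linear_combination a.im * hre
  have hprod : (a - zeta k) * (a - (starRingEnd ℂ) (zeta k : ℂ)) = 0 := by
    have hzz : (zeta k : ℂ) * (starRingEnd ℂ) (zeta k : ℂ) = 1 := by
      rw [Complex.mul_conj, Circle.normSq_coe]; simp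
    have hsum : (zeta k : ℂ) + (starRingEnd ℂ) (zeta k : ℂ) = c := by
      have hz0 : (zeta k : ℂ) ≠ 0 := Circle.coe_ne_zero _
      apply mul_left_cancel₀ hz0
      linear_combination hz + hzz
    linear_combination haa + hzz - a * hsum
  rcases mul_eq_zero.1 hprod with h | h
  · exact ⟨τ, mem_equivariantMaps_of_eq hk (by rw [ha, sub_eq_zero.1 h]),
      Or.inl fun t z => by rw [hu, hτ]⟩
  · refine ⟨fun i => (starRingEnd ℂ) (τ i), mem_equivariantMaps_of_eq hk ?_,
      Or.inr fun t z => ?_⟩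
    · rw [ha, map_mul, sub_eq_zero.1 h, Complex.conj_conj]
    · rw [hu, hτ]
      simp [latticeMap]

/-! ### The dimension of the restricted representation spaces -/

section EvalMap

variable {k : ℕ} {H : Subgroup (Gam k)}

/-- Evaluation of equivariant maps at finitely many elements of a subgroup. -/
def evalMap (F : Finset H) : equivariantMaps k →ₗ[ℂ] (F → ℂ) where
  toFun τ h := latticeMap τ h.1.1.left
  map_add' σ τ := by ext; simp [latticeMap_add]
  map_smul' c τ := by ext; simp [latticeMap_smul]

/-- The equivariant maps that vanish on a subgroup of `Γ_k`. -/
def annihilator (H : Subgroup (Gam k)) : Submodule ℂ (equivariantMaps k) where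
  carrier := {τ | ∀ h ∈ H, latticeMap τ h.left = 0}
  add_mem' hσ hτ h hh := by
    rw [Submodule.coe_add, latticeMap_add, hσ h hh, hτ h hh, add_zero]
  zero_mem' h _ := by simp [latticeMap]
  smul_mem' c τ hτ h hh := by
    rw [Submodule.coe_smul, latticeMap_smul, hτ h hh, mul_zero]

theorem annihilator_le_ker (F : Finset H) : annihilator H ≤ LinearMap.ker (evalMap F) := by
  intro τ hτ
  rw [LinearMap.mem_ker]
  ext h
  exact hτ _ h.1.2

/-- Kernels shrink as `F` grows; one of least dimension no longer changes when any further element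
is added. -/
theorem exists_ker_evalMap_eq (H : Subgroup (Gam k)) :
    ∃ F : Finset H, LinearMap.ker (evalMap F) = annihilator H := by
  classical
  let d : Finset H → ℕ := fun F => Module.finrank ℂ (LinearMap.ker (evalMap F))
  obtain ⟨F, hF⟩ : ∃ F, ∀ F', d F ≤ d F' := ⟨Function.argmin d, fun F' => Function.argmin_le d F'⟩
  refine ⟨F, le_antisymm (fun τ hτ h hh => ?_) (annihilator_le_ker F)⟩
  have hle : LinearMap.ker (evalMap (insert ⟨h, hh⟩ F)) ≤ LinearMap.ker (evalMap F) := by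
    intro σ hσ
    rw [LinearMap.mem_ker] at hσ ⊢
    ext g
    exact congrFun hσ ⟨g.1, Finset.mem_insert_of_mem g.2⟩
  rw [← Submodule.eq_of_le_of_finrank_le hle (hF _), LinearMap.mem_ker] at hτ
  exact congrFun hτ ⟨⟨h, hh⟩, Finset.mem_insert_self _ _⟩

theorem finrank_range_evalMap_le (F : Finset H) :
    Module.finrank ℂ (LinearMap.range (evalMap F)) + Module.finrank ℂ (annihilator H) ≤
      Module.finrank ℂ (equivariantMaps k) := by
  rw [← (evalMap F).finrank_range_add_finrank_ker]
  gcongr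
  exact Submodule.finrank_mono (annihilator_le_ker F)

/-- Translations as elements of a power of `Euc(2)`. -/
def translationTuple {ι : Type*} (u : ι → ℂ) (i : ι) : Plane × (Plane →L[ℝ] Plane) :=
  (toPlane (u i), ContinuousLinearMap.id ℝ Plane)

/-- Lipschitz maps do not raise Hausdorff dimension. This map and conjugation give the upper bound
in `dimH_RepRes`, and the projection to translation vectors gives the lower bound. -/
theorem lipschitzWith_translationTuple {ι : Type*} [Fintype ι] :
    LipschitzWith 1 (translationTuple (ι := ι)) := by
  refine LipschitzWith.of_dist_le_mul fun u v => ?_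
  rw [NNReal.coe_one, one_mul]
  refine (dist_pi_le_iff dist_nonneg).2 fun i => ?_
  rw [translationTuple, translationTuple, Prod.dist_eq, dist_self, toPlane.dist_map]
  exact max_le (dist_le_pi_dist u v i) dist_nonneg

theorem lipschitzWith_conj {ι : Type*} [Fintype ι] :
    LipschitzWith 1 fun (u : ι → ℂ) (i : ι) => (starRingEnd ℂ) (u i) := by
  refine LipschitzWith.of_dist_le_mul fun u v => ?_
  rw [NNReal.coe_one, one_mul]
  refine (dist_pi_le_iff dist_nonneg).2 fun i => ?_
  rw [Complex.dist_conj_conj]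
  exact dist_le_pi_dist u v i

theorem lipschitzWith_fst_tuple {ι : Type*} [Fintype ι] :
    LipschitzWith 1 fun (x : ι → Plane × (Plane →L[ℝ] Plane)) (i : ι) =>
      toPlane.symm (x i).1 := by
  refine LipschitzWith.of_dist_le_mul fun u v => ?_
  rw [NNReal.coe_one, one_mul]
  refine (dist_pi_le_iff dist_nonneg).2 fun i => ?_
  rw [toPlane.symm.dist_map]
  exact (le_max_left _ _).trans (dist_le_pi_dist u v i)

theorem dimH_submodule {W : Type*} [NormedAddCommGroup W] [NormedSpace ℝ W]
    [FiniteDimensional ℝ W] (U : Submodule ℝ W) :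
    dimH (U : Set W) = Module.finrank ℝ U := by
  rw [← Real.dimH_univ_eq_finrank, ← (isometry_subtype_coe (s := (U : Set W))).dimH_image,
    Set.image_univ, Subtype.range_coe]

/-- A linear map is open onto its range, so the image has nonempty interior there. -/
theorem dimH_image_of_isOpen {V W : Type*} [NormedAddCommGroup V] [NormedSpace ℝ V]
    [NormedAddCommGroup W] [NormedSpace ℝ W] [FiniteDimensional ℝ W] (f : V →ₗ[ℝ] W)
    [FiniteDimensional ℝ V] {U : Set V} (hU : IsOpen U) (hne : U.Nonempty) :
    dimH (f '' U) = Module.finrank ℝ (LinearMap.range f) := by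
  have h1 : f '' U = Subtype.val '' (f.rangeRestrict '' U) := by
    rw [Set.image_image]
    rfl
  have h2 : IsOpenMap f.rangeRestrict :=
    LinearMap.isOpenMap_of_finiteDimensional _ f.surjective_rangeRestrict
  have h3 : Isometry (Subtype.val : LinearMap.range f → W) := isometry_subtype_coe
  rw [h1, h3.dimH_image]
  apply Real.dimH_of_nonempty_interior
  rw [(h2 U hU).interior_eq]
  exact hne.image _

theorem inl_left_of_mem {g : Gam k} (hg : g ∈ transGroup k) :
    SemidirectProduct.inl g.left = g := by
  obtain ⟨t, rfl⟩ := hg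
  rfl

/-- The evaluated representations lie in the union of a linear space and its conjugate, written as
translations, and contain the part that comes from an open set of lattices. The factor two passes
from complex to real dimension. -/
theorem dimH_RepRes (hk : k = 2 ∨ k = 3 ∨ k = 4 ∨ k = 6) (hH : H ≤ transGroup k)
    (F : Finset H) :
    dimH ((fun (Φ : H →* Euc2) (g : F) => eucCoord (Φ g)) '' RepRes H) =
      ((2 * Module.finrank ℂ (LinearMap.range (evalMap F)) : ℕ) : ENNReal) := by
  have hk0 : k ≠ 0 := by omega
  set e := (evalMap F).restrictScalars ℝ with he
  have hrange : Module.finrank ℝ (LinearMap.range e) =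
      2 * Module.finrank ℂ (LinearMap.range (evalMap F)) :=
    finrank_real_of_complex (LinearMap.range (evalMap F))
  rw [← hrange]
  apply le_antisymm
  · have hsub : ((fun (Φ : H →* Euc2) (g : F) => eucCoord (Φ g)) '' RepRes H) ⊆
        translationTuple '' (LinearMap.range e : Set (F → ℂ)) ∪
        translationTuple '' ((fun (u : F → ℂ) (i : F) => (starRingEnd ℂ) (u i)) ''
          (LinearMap.range e : Set (F → ℂ))) := by
      rintro _ ⟨_, ⟨Ψ, hΨ, rfl⟩, rfl⟩
      obtain ⟨τ, hτ, h | h⟩ := Rep.exists_equivariantMaps hk hΨ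
      · refine Or.inl ⟨e ⟨τ, hτ⟩, ⟨_, rfl⟩, ?_⟩
        ext1 g
        refine (eucCoord_of_complexForm fun z => ?_).symm
        have := h g.1.1.left z
        rwa [inl_left_of_mem (hH g.1.2)] at this
      · refine Or.inr ⟨_, ⟨e ⟨τ, hτ⟩, ⟨_, rfl⟩, rfl⟩, ?_⟩
        ext1 g
        refine (eucCoord_of_complexForm fun z => ?_).symm
        have := h g.1.1.left z
        rwa [inl_left_of_mem (hH g.1.2)] at this
    refine (dimH_mono hsub).trans ?_
    rw [dimH_union, ← dimH_submodule]
    exact max_le (lipschitzWith_translationTuple.dimH_image_le _)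
      ((lipschitzWith_translationTuple.dimH_image_le _).trans (lipschitzWith_conj.dimH_image_le _))
  · rw [← dimH_image_of_isOpen e (isOpen_latticeForms k) (latticeForms_nonempty hk)]
    refine le_trans (dimH_mono ?_) (lipschitzWith_fst_tuple.dimH_image_le _)
    rintro _ ⟨τ, hτ, rfl⟩
    refine ⟨_, ⟨_, ⟨latticeRep τ, latticeRep_mem_Rep hk0 hτ, rfl⟩, rfl⟩, ?_⟩
    ext1 g
    have : eucCoord (latticeRep τ g.1.1) = _ := eucCoord_of_complexForm fun z => by
      rw [← inl_left_of_mem (hH g.1.2), complexForm_latticeRep, SemidirectProduct.right_inl,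
        map_one, Circle.coe_one, one_mul]
    simp only [MonoidHom.comp_apply, Subgroup.subtype_apply]
    rw [this, LinearIsometryEquiv.symm_apply_apply]
    rfl

theorem rep_add_finrank_annihilator (hk : k = 2 ∨ k = 3 ∨ k = 4 ∨ k = 6)
    (hH : H ≤ transGroup k) :
    rep H + 2 * Module.finrank ℂ (annihilator H) = 2 * Module.finrank ℂ (equivariantMaps k) := by
  obtain ⟨F, hF⟩ := exists_ker_evalMap_eq H
  have h1 := (evalMap F).finrank_range_add_finrank_ker
  rw [hF] at h1
  have h2 : repSpaceDim (RepRes H) =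
      ((2 * Module.finrank ℂ (LinearMap.range (evalMap F)) : ℕ) : ENNReal) := by
    apply le_antisymm
    · refine iSup_le fun F' => ?_
      rw [dimH_RepRes hk hH]
      have := finrank_range_evalMap_le F'
      gcongr
      omega
    · rw [← dimH_RepRes hk hH]
      exact le_iSup (fun F : Finset H =>
        dimH ((fun (Φ : H →* Euc2) (g : F) => eucCoord (Φ g)) '' RepRes H)) F
  rw [rep, h2, ENNReal.toReal_natCast, ← h1]
  push_cast
  ring

theorem annihilator_transGroup (k : ℕ) : annihilator (transGroup k) = ⊥ := by
  refine eq_bot_iff.2 fun τ hτ => ?_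
  have h : ∀ i, τ.1 i = 0 := by
    intro i
    have := hτ (SemidirectProduct.inl (Multiplicative.ofAdd (Pi.single i 1))) ⟨_, rfl⟩
    fin_cases i <;> simpa [latticeMap] using this
  exact Subtype.ext (funext h)

theorem rep_transGroup (hk : k = 2 ∨ k = 3 ∨ k = 4 ∨ k = 6) :
    rep (transGroup k) = 2 * Module.finrank ℂ (equivariantMaps k) := by
  have := rep_add_finrank_annihilator hk (le_refl (transGroup k))
  rw [annihilator_transGroup, finrank_bot] at this
  simpa using this

end EvalMap

/-! ### Partition into two independent sets -/

section Partition

variable {E W K : Type*} [Field K] [AddCommGroup W] [Module K W]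

/-- The rank of a finite set of vectors. -/
def spanRank (w : E → W) (F : Finset E) : ℕ := Module.finrank K (Submodule.span K (w '' F))

variable (w : E → W)

theorem spanRank_mono [FiniteDimensional K W] {F F' : Finset E} (h : F ⊆ F') :
    spanRank (K := K) w F ≤ spanRank (K := K) w F' :=
  Submodule.finrank_mono (Submodule.span_mono (Set.image_mono (Finset.coe_subset.2 h)))

theorem spanRank_le_card (F : Finset E) : spanRank (K := K) w F ≤ F.card := by
  classical
  have := finrank_span_finset_le_card (R := K) (F.image w)
  rw [Finset.coe_image] at this
  exact this.trans Finset.card_image_le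

/-- This is the dimension formula for a sum of subspaces; the span of the intersection may be
smaller than the intersection of the spans. -/
theorem spanRank_submodular [FiniteDimensional K W] [DecidableEq E] (F F' : Finset E) :
    spanRank (K := K) w (F ∪ F') + spanRank (K := K) w (F ∩ F') ≤
      spanRank (K := K) w F + spanRank (K := K) w F' := by
  have h := Submodule.finrank_sup_add_finrank_inf_eq (Submodule.span K (w '' F))
    (Submodule.span K (w '' F'))
  rw [spanRank, spanRank, spanRank, spanRank, ← h, Finset.coe_union, Set.image_union,
    Submodule.span_union]
  gcongr
  refine Submodule.finrank_mono (le_inf ?_ ?_) <;>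
    exact Submodule.span_mono (Set.image_mono (by simp))

/-- The inequality survives the removal of a common element from at least one of the two sets, so
the overlap can be shrunk to nothing. -/
theorem exists_disjoint_of_card_le [FiniteDimensional K W] [DecidableEq E] (X₁ X₂ : Finset E)
    (h : ∀ F : Finset E, F.card ≤
      spanRank (K := K) w (F ∩ X₁) + spanRank (K := K) w (F ∩ X₂)) :
    ∃ Y₁ Y₂ : Finset E, Disjoint Y₁ Y₂ ∧ ∀ F : Finset E, F.card ≤
      spanRank (K := K) w (F ∩ Y₁) + spanRank (K := K) w (F ∩ Y₂) := by
  induction hn : (X₁ ∩ X₂).card generalizing X₁ X₂ with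
  | zero =>
    exact ⟨X₁, X₂, Finset.disjoint_iff_inter_eq_empty.2 (Finset.card_eq_zero.1 hn), h⟩
  | succ n ih =>
    obtain ⟨e, he⟩ := Finset.card_pos.1 (Nat.lt_of_lt_of_eq (Nat.succ_pos n) hn.symm)
    have hcard : ((X₁ ∩ X₂).erase e).card = n := by rw [Finset.card_erase_of_mem he, hn]; rfl
    by_cases h1 : ∀ F : Finset E, F.card ≤
        spanRank (K := K) w (F ∩ X₁.erase e) + spanRank (K := K) w (F ∩ X₂)
    · exact ih _ _ h1 (by rw [Finset.erase_inter, hcard])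
    by_cases h2 : ∀ F : Finset E, F.card ≤
        spanRank (K := K) w (F ∩ X₁) + spanRank (K := K) w (F ∩ X₂.erase e)
    · exact ih _ _ h2 (by rw [Finset.inter_erase, hcard])
    exfalso
    push Not at h1 h2
    obtain ⟨A, hA⟩ := h1
    obtain ⟨B, hB⟩ := h2
    have heA : e ∈ A := by
      by_contra heA
      have : A ∩ X₁.erase e = A ∩ X₁ := by
        rw [Finset.inter_erase, Finset.erase_eq_of_notMem]
        exact fun h => heA (Finset.mem_inter.1 h).1
      rw [this] at hA
      exact absurd (h A) (not_le.2 hA)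
    have heB : e ∈ B := by
      by_contra heB
      have : B ∩ X₂.erase e = B ∩ X₂ := by
        rw [Finset.inter_erase, Finset.erase_eq_of_notMem]
        exact fun h => heB (Finset.mem_inter.1 h).1
      rw [this] at hB
      exact absurd (h B) (not_le.2 hB)
    -- Uncrossing: the violations at `A` and `B` total at least two, but the inequality for `A ∪ B`
    -- and for `A ∩ B` without `e` loses only one.
    have s1 := spanRank_submodular (K := K) w (A ∩ X₁.erase e) (B ∩ X₁)
    have s2 := spanRank_submodular (K := K) w (A ∩ X₂) (B ∩ X₂.erase e)
    have e1 : A ∩ X₁.erase e ∪ B ∩ X₁ = (A ∪ B) ∩ X₁ := by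
      ext x; by_cases hx : x = e <;> simp [hx, heB] ; tauto
    have e2 : A ∩ X₂ ∪ B ∩ X₂.erase e = (A ∪ B) ∩ X₂ := by
      ext x; by_cases hx : x = e <;> simp [hx, heA] ; tauto
    have e3 : A ∩ X₁.erase e ∩ (B ∩ X₁) = (A ∩ B).erase e ∩ X₁ := by
      ext x; simp; tauto
    have e4 : A ∩ X₂ ∩ (B ∩ X₂.erase e) = (A ∩ B).erase e ∩ X₂ := by
      ext x; simp; tauto
    rw [e1, e3] at s1
    rw [e2, e4] at s2
    have h3 := h (A ∪ B)
    have h4 := h ((A ∩ B).erase e)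
    rw [Finset.card_erase_of_mem (Finset.mem_inter.2 ⟨heA, heB⟩)] at h4
    have h5 := Finset.card_union_add_card_inter A B
    omega

/-- A matroid partition theorem: a finite family of vectors in which the size of every subfamily
is at most twice its rank is the union of two subfamilies in which the size of every subfamily is
at most its rank. -/
theorem exists_partition_of_card_le [FiniteDimensional K W] [Fintype E] [DecidableEq E]
    (h : ∀ F : Finset E, F.card ≤ 2 * spanRank (K := K) w F) :
    ∃ X : Finset E, X.card ≤ spanRank (K := K) w X ∧ Xᶜ.card ≤ spanRank (K := K) w Xᶜ := by
  obtain ⟨Y₁, Y₂, hd, hY⟩ := exists_disjoint_of_card_le (K := K) w Finset.univ Finset.univ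
    fun F => by rw [Finset.inter_univ, ← two_mul]; exact h F
  have h0 : spanRank (K := K) w ∅ = 0 := Nat.le_zero.1 (spanRank_le_card w ∅)
  refine ⟨Y₁, ?_, ?_⟩
  · have := hY Y₁
    rwa [Finset.inter_self, Finset.disjoint_iff_inter_eq_empty.1 hd, h0, add_zero] at this
  · have := hY Y₁ᶜ
    rw [Finset.inter_comm, Finset.inter_compl, h0, zero_add] at this
    exact this.trans (spanRank_mono w Finset.inter_subset_left)

end Partition

/-! ### Cycles and the incidence matrix -/

namespace ColoredGraph

variable {V E Γ : Type*} {G : ColoredGraph V E Γ}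

theorem component_tail_eq (G : ColoredGraph V E Γ) (e : E) :
    G.component (G.tail e) = G.component (G.head e) :=
  Quot.sound ⟨e, rfl, rfl⟩

instance [Finite V] : Finite G.Component := Quot.finite _

theorem component_base (G : ColoredGraph V E Γ) (c : G.Component) :
    G.component (G.base c) = c := Quot.out_eq c

/-- The edge `e` joins `u` and `v`, in one direction or the other. -/
def Joins (G : ColoredGraph V E Γ) (e : E) (u v : V) : Prop :=
  (G.tail e = u ∧ G.head e = v) ∨ (G.head e = u ∧ G.tail e = v)

namespace Walk

theorem exists_cons {u v w : V} {e : E} (he : G.Joins e u v) (p : G.Walk v w) :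
    ∃ q : G.Walk u w, q.edges = e :: p.edges ∧ q.starts = u :: p.starts := by
  rcases he with ⟨hu, hv⟩ | ⟨hu, hv⟩
  · exact ⟨fwd e hu hv p, rfl, rfl⟩
  · exact ⟨bwd e hu hv p, rfl, rfl⟩

/-- The vertices of a walk. -/
def verts {u v : V} (p : G.Walk u v) : List V := p.starts ++ [v]

theorem mem_verts_of_mem_edges {u v : V} (p : G.Walk u v) {e : E} (he : e ∈ p.edges) :
    G.tail e ∈ p.verts ∧ G.head e ∈ p.verts := by
  induction p with
  | nil v => simp [edges] at he
  | @fwd u v w e' hu hv p ih =>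
    have hvp : v ∈ p.verts := by cases p <;> simp [verts, starts]
    rcases List.mem_cons.1 he with rfl | he
    · exact ⟨by simp [verts, starts, hu], List.mem_cons_of_mem _ (hv ▸ hvp)⟩
    · exact ⟨List.mem_cons_of_mem _ (ih he).1, List.mem_cons_of_mem _ (ih he).2⟩
  | @bwd u v w e' hu hv p ih =>
    have hvp : v ∈ p.verts := by cases p <;> simp [verts, starts]
    rcases List.mem_cons.1 he with rfl | he
    · exact ⟨List.mem_cons_of_mem _ (hv ▸ hvp), by simp [verts, starts, hu]⟩
    · exact ⟨List.mem_cons_of_mem _ (ih he).1, List.mem_cons_of_mem _ (ih he).2⟩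

theorem nodup_edges_of_nodup_verts {u v : V} (p : G.Walk u v) (hp : p.verts.Nodup) :
    p.edges.Nodup := by
  induction p with
  | nil v => simp [edges]
  | fwd e hu hv p ih =>
    have h := List.nodup_cons.1 hp
    exact List.nodup_cons.2 ⟨fun he => h.1 (hu ▸ (p.mem_verts_of_mem_edges he).1), ih h.2⟩
  | bwd e hu hv p ih =>
    have h := List.nodup_cons.1 hp
    exact List.nodup_cons.2 ⟨fun he => h.1 (hu ▸ (p.mem_verts_of_mem_edges he).2), ih h.2⟩

theorem exists_prefix {u v w : V} (p : G.Walk u v) (hw : w ∈ p.verts) :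
    ∃ q : G.Walk u w, q.verts <+: p.verts ∧ q.edges <+: p.edges := by
  induction p with
  | nil v =>
    simp only [verts, starts, List.nil_append, List.mem_singleton] at hw
    subst hw
    exact ⟨nil w, List.prefix_rfl, List.prefix_rfl⟩
  | @fwd u v x e hu hv p ih =>
    rcases List.mem_cons.1 hw with rfl | hw
    · exact ⟨nil w, by simp [verts, starts], by simp [edges]⟩
    · obtain ⟨q, h1, h2⟩ := ih hw
      exact ⟨fwd e hu hv q, List.cons_prefix_cons.2 ⟨rfl, h1⟩, List.cons_prefix_cons.2 ⟨rfl, h2⟩⟩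
  | @bwd u v x e hu hv p ih =>
    rcases List.mem_cons.1 hw with rfl | hw
    · exact ⟨nil w, by simp [verts, starts], by simp [edges]⟩
    · obtain ⟨q, h1, h2⟩ := ih hw
      exact ⟨bwd e hu hv q, List.cons_prefix_cons.2 ⟨rfl, h1⟩, List.cons_prefix_cons.2 ⟨rfl, h2⟩⟩

theorem component_eq {u v : V} (p : G.Walk u v) : G.component u = G.component v := by
  induction p with
  | nil v => rfl
  | fwd e hu hv p ih => rw [← ih, ← hu, ← hv, component_tail_eq]
  | bwd e hu hv p ih => rw [← ih, ← hu, ← hv, component_tail_eq]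

theorem component_of_mem_edges {u v : V} (p : G.Walk u v) {e : E} (he : e ∈ p.edges) :
    G.component (G.tail e) = G.component u := by
  induction p with
  | nil v => simp [edges] at he
  | fwd e' hu hv p ih =>
    rcases List.mem_cons.1 he with rfl | he
    · rw [hu]
    · rw [ih he, ← hu, ← hv, component_tail_eq]
  | bwd e' hu hv p ih =>
    rcases List.mem_cons.1 he with rfl | he
    · rw [component_tail_eq, hu]
    · rw [ih he, ← hu, ← hv, component_tail_eq]

end Walk

/-- A nonempty set of edges without vertices of degree one contains a cycle. -/
theorem exists_isCycle_subset [Finite V] {S : Set E} (hne : S.Nonempty)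
    (hS : ∀ e ∈ S, ∀ v, (G.tail e = v ∨ G.head e = v) → G.tail e ≠ G.head e →
      ∃ e' ∈ S, e' ≠ e ∧ (G.tail e' = v ∨ G.head e' = v)) :
    ∃ C ⊆ S, G.IsCycle C := by
  classical
  have := Fintype.ofFinite V
  by_cases hloop : ∃ e ∈ S, G.tail e = G.head e
  · obtain ⟨e, he, hl⟩ := hloop
    exact ⟨{e}, by simpa using he, G.tail e, Walk.fwd e rfl hl.symm (Walk.nil _),
      by simp [Walk.edges], by simp [Walk.edges], by simp [Walk.starts], by simp [Walk.edges]⟩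
  push Not at hloop
  by_contra hno
  -- Without a cycle, simple paths in `S` can be prolonged forever at their front vertex `u`, which
  -- exceeds the number of vertices. The first edge `e` is kept apart so that the next edge can be
  -- chosen different from it.
  have key : ∀ n : ℕ, ∃ (u v w : V) (e : E) (p : G.Walk v w), G.Joins e u v ∧ e ∈ S ∧
      (∀ e' ∈ p.edges, e' ∈ S) ∧ (u :: p.verts).Nodup ∧ n ≤ p.verts.length := by
    intro n
    induction n with
    | zero =>
      obtain ⟨e, he⟩ := hne
      refine ⟨G.tail e, G.head e, G.head e, e, Walk.nil _, Or.inl ⟨rfl, rfl⟩, he,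
        by simp [Walk.edges], ?_, Nat.zero_le _⟩
      simpa [Walk.verts, Walk.starts] using hloop e he
    | succ n ih =>
      obtain ⟨u, v, w, e, p, hj, he, hp, hnd, hlen⟩ := ih
      have hvu : v ∈ p.verts := by cases p <;> simp [Walk.verts, Walk.starts]
      obtain ⟨q, hq1, hq2⟩ := Walk.exists_cons hj p
      have hqv : q.verts = u :: p.verts := by simp [Walk.verts, hq2]
      have hqS : ∀ e' ∈ q.edges, e' ∈ S := by
        intro e' he'
        rw [hq1] at he'
        rcases List.mem_cons.1 he' with rfl | he'
        exacts [he, hp _ he']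
      obtain ⟨e', he', hne', hinc⟩ := hS e he u (by
        rcases hj with h | h
        exacts [Or.inl h.1, Or.inr h.1]) (hloop e he)
      obtain ⟨x, hx⟩ : ∃ x, G.Joins e' x u := by
        rcases hinc with h | h
        exacts [⟨_, Or.inr ⟨rfl, h⟩⟩, ⟨_, Or.inl ⟨rfl, h⟩⟩]
      by_cases hxq : x ∈ q.verts
      · exfalso
        obtain ⟨r, hr1, hr2⟩ := q.exists_prefix hxq
        obtain ⟨c, hc1, hc2⟩ := Walk.exists_cons hx r
        have he'q : e' ∉ q.edges := by
          rw [hq1]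
          intro h
          rcases List.mem_cons.1 h with h | h
          · exact hne' h
          · have hu : u ∉ p.verts := (List.nodup_cons.1 hnd).1
            have := p.mem_verts_of_mem_edges h
            rcases hinc with h | h
            exacts [hu (h ▸ this.1), hu (h ▸ this.2)]
        have hrnd : r.verts.Nodup := (hqv ▸ hnd).sublist hr1.sublist
        refine hno ⟨_, ?_, x, c, ?_, ?_, ?_, rfl⟩
        · intro a ha
          simp only [Set.mem_ofPred_eq, hc1] at ha
          rcases List.mem_cons.1 ha with rfl | ha
          exacts [he', hqS _ (hr2.subset ha)]
        · simp [hc1]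
        · rw [hc1]
          exact List.nodup_cons.2 ⟨fun h => he'q (hr2.subset h), r.nodup_edges_of_nodup_verts hrnd⟩
        · rw [hc2]
          rw [Walk.verts] at hrnd
          -- The closed walk starts its steps at the vertices of `r`, with the endpoint `x` moved to
          -- the front.
          exact (List.perm_append_singleton x r.starts).nodup_iff.1 hrnd
      · exact ⟨x, u, w, e', q, hx, he', hqS, List.nodup_cons.2 ⟨hxq, hqv ▸ hnd⟩, by
          rw [hqv, List.length_cons]; omega⟩
  obtain ⟨u, v, w, e, p, -, -, -, hnd, hlen⟩ := key (Fintype.card V)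
  have := hnd.length_le_card
  rw [List.length_cons] at this
  omega

end ColoredGraph

namespace ColoredGraph

section Incidence

open Classical

variable {V E Γ : Type*} {G : ColoredGraph V E Γ}

/-- The signed incidence matrix of a directed multigraph. -/
def incidence (G : ColoredGraph V E Γ) (R : Type*) [CommRing R] : Matrix V E R :=
  Matrix.of fun v e => (if G.head e = v then 1 else 0) - if G.tail e = v then 1 else 0

theorem incidence_mulVec_single [Fintype E] (G : ColoredGraph V E Γ) (R : Type*) [CommRing R] (e : E) :
    (G.incidence R).mulVec (Pi.single e 1) = Pi.single (G.head e) 1 - Pi.single (G.tail e) 1 := by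
  ext v
  simp [incidence, Matrix.col_apply, Pi.single_apply, eq_comm]

/-- The signed number of times that a walk crosses each edge. -/
def Walk.chain (R : Type*) [CommRing R] {u v : V} : G.Walk u v → E → R
  | nil _ => 0
  | fwd e _ _ p => Pi.single e 1 + p.chain R
  | bwd e _ _ p => -Pi.single e 1 + p.chain R

theorem Walk.incidence_mulVec_chain [Fintype E] (R : Type*) [CommRing R] {u v : V} (p : G.Walk u v) :
    (G.incidence R).mulVec (p.chain R) = Pi.single v 1 - Pi.single u 1 := by
  induction p with
  | nil v => simp [chain]
  | fwd e hu hv p ih =>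
    rw [chain, Matrix.mulVec_add, ih, incidence_mulVec_single, hu, hv]
    abel
  | bwd e hu hv p ih =>
    rw [chain, Matrix.mulVec_add, Matrix.mulVec_neg, ih, incidence_mulVec_single, hu, hv]
    abel

theorem Walk.chain_eq_zero_of_notMem (R : Type*) [CommRing R] {u v : V} (p : G.Walk u v) {e : E}
    (he : e ∉ p.edges) : p.chain R e = 0 := by
  induction p with
  | nil v => rfl
  | fwd e' hu hv p ih =>
    obtain ⟨h1, h2⟩ := not_or.1 (mt List.mem_cons.2 he)
    simp [chain, ih h2, Pi.single_eq_of_ne h1]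
  | bwd e' hu hv p ih =>
    obtain ⟨h1, h2⟩ := not_or.1 (mt List.mem_cons.2 he)
    simp [chain, ih h2, Pi.single_eq_of_ne h1]

theorem zmod_two_eq_one {x : ZMod 2} (hx : x ≠ 0) : x = 1 := by
  revert x
  decide

theorem Walk.chain_zmod_two {u v : V} (p : G.Walk u v) (hp : p.edges.Nodup) :
    p.chain (ZMod 2) = Set.indicator {e | e ∈ p.edges} 1 := by
  have key : ∀ e, p.chain (ZMod 2) e = (p.edges.count e : ZMod 2) := by
    intro e
    clear hp
    induction p with
    | nil v => simp [chain, edges]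
    | fwd e' hu hv p ih =>
      by_cases h : e' = e
      · simp [chain, edges, ih, h, add_comm]
      · simp [chain, edges, ih, h]
    | bwd e' hu hv p ih =>
      by_cases h : e' = e
      · simp [chain, edges, ih, h, add_comm, CharTwo.neg_eq]
      · simp [chain, edges, ih, h]
  ext e
  rw [key]
  by_cases he : e ∈ p.edges
  · rw [List.count_eq_one_of_mem hp he, Set.indicator_of_mem (by exact he)]
    simp
  · rw [List.count_eq_zero_of_not_mem he, Set.indicator_of_notMem (by exact he)]
    simp

/-- The support of a nonzero element of the kernel of the incidence matrix contains a cycle. -/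
theorem exists_isCycle_of_incidence_mulVec_eq_zero [Finite V] [Fintype E] {R : Type*} [CommRing R] {z : E → R}
    (hz : (G.incidence R).mulVec z = 0) (hz0 : z ≠ 0) :
    ∃ C ⊆ Function.support z, G.IsCycle C := by
  refine exists_isCycle_subset (Function.support_nonempty_iff.2 hz0) fun e he v hev hl => ?_
  by_contra hno
  push Not at hno
  have h := congrFun hz v
  rw [Matrix.mulVec, dotProduct, Finset.sum_eq_single e, Pi.zero_apply] at h
  · apply he
    rcases hev with hev | hev
    · have : G.head e ≠ v := fun h => hl (hev.trans h.symm)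
      simpa [incidence, hev, this] using h
    · have : G.tail e ≠ v := fun h => hl (h.trans hev.symm)
      simpa [incidence, hev, this] using h
  · intro e' _ hne
    by_cases hz' : z e' = 0
    · rw [hz', mul_zero]
    · have := hno e' hz' hne
      simp [incidence, this.1, this.2]
  · simp

theorem IsCycle.nonempty {C : Set E} (hC : G.IsCycle C) : C.Nonempty := by
  obtain ⟨v, p, hne, -, -, rfl⟩ := hC
  exact List.exists_mem_of_ne_nil _ hne

theorem IsCycle.exists_component {C : Set E} (hC : G.IsCycle C) :
    ∃ c, ∀ e ∈ C, G.component (G.tail e) = c := by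
  obtain ⟨v, p, -, -, -, rfl⟩ := hC
  exact ⟨_, fun e he => p.component_of_mem_edges he⟩

theorem IsCycle.incidence_mulVec_indicator [Fintype E] {C : Set E} (hC : G.IsCycle C) :
    (G.incidence (ZMod 2)).mulVec (C.indicator 1) = 0 := by
  obtain ⟨v, p, -, hnd, -, rfl⟩ := hC
  rw [← p.chain_zmod_two hnd, p.incidence_mulVec_chain (ZMod 2), sub_self]

theorem finrank_ker_transpose_incidence [Fintype V] (G : ColoredGraph V E Γ) (R : Type*) [Field R] :
    Module.finrank R (LinearMap.ker (G.incidence R).transpose.mulVecLin) =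
      Nat.card G.Component := by
  have hsurj : Function.Surjective G.component := Quot.mk_surjective
  have h1 : LinearMap.ker (G.incidence R).transpose.mulVecLin =
      LinearMap.range (LinearMap.funLeft R R G.component) := by
    ext y
    have h2 : y ∈ LinearMap.ker (G.incidence R).transpose.mulVecLin ↔
        ∀ e, y (G.tail e) = y (G.head e) := by
      rw [LinearMap.mem_ker, funext_iff]
      refine forall_congr' fun e => ?_
      simp only [Matrix.mulVecLin_apply, Matrix.mulVec, dotProduct, Matrix.transpose_apply,
        incidence, Matrix.of_apply, sub_mul, ite_mul, one_mul, zero_mul, Finset.sum_sub_distrib,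
        Finset.sum_ite_eq, Finset.mem_univ, if_true, Pi.zero_apply, sub_eq_zero]
      exact eq_comm
    rw [h2]
    constructor
    · intro h
      refine ⟨fun c => Quot.lift y (by rintro _ _ ⟨e, rfl, rfl⟩; exact h e) c, ?_⟩
      ext v
      rfl
    · rintro ⟨x, rfl⟩ e
      simp [LinearMap.funLeft_apply, component_tail_eq]
  have := Fintype.ofFinite G.Component
  rw [h1, LinearMap.finrank_range_of_inj (LinearMap.funLeft_injective_of_surjective R R _ hsurj),
    Module.finrank_fintype_fun_eq_card, Nat.card_eq_fintype_card]

/-- Euler's relation for the cycle space: the incidence matrix and its transpose have equal rank,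
and the kernel of the transpose consists of the functions constant on components. -/
theorem card_edges_add_card_component [Fintype V] [Fintype E] (G : ColoredGraph V E Γ) (R : Type*) [Field R] :
    Nat.card E + Nat.card G.Component = Nat.card V +
      Module.finrank R (LinearMap.ker (G.incidence R).mulVecLin) := by
  have h1 := (G.incidence R).mulVecLin.finrank_range_add_finrank_ker
  have h2 := (G.incidence R).transpose.mulVecLin.finrank_range_add_finrank_ker
  have h3 := (G.incidence R).rank_transpose
  rw [Matrix.rank, Matrix.rank] at h3
  rw [Module.finrank_fintype_fun_eq_card, ← Nat.card_eq_fintype_card] at h1 h2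
  rw [finrank_ker_transpose_incidence] at h2
  omega

/-! ### One cycle per component, and the cycle space modulo two -/

section CycleFamily

variable {C : G.Component → Set E}

theorem sum_smul_indicator_apply [Fintype G.Component]
    (hcomp : ∀ c, ∀ e ∈ C c, G.component (G.tail e) = c) (g : G.Component → ZMod 2) (e : E) :
    (∑ c, g c • (C c).indicator (1 : E → ZMod 2)) e =
      g (G.component (G.tail e)) * (C (G.component (G.tail e))).indicator 1 e := by
  rw [Finset.sum_apply, Finset.sum_eq_single (G.component (G.tail e))]
  · rfl
  · intro c _ hc
    rw [Pi.smul_apply, Set.indicator_of_notMem fun he => hc (hcomp c e he).symm, smul_zero]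
  · simp

theorem linearIndependent_indicator [Finite V] (hC : ∀ c, G.IsCycle (C c))
    (hcomp : ∀ c, ∀ e ∈ C c, G.component (G.tail e) = c) :
    LinearIndependent (ZMod 2) fun c => (C c).indicator (1 : E → ZMod 2) := by
  have := Fintype.ofFinite G.Component
  rw [Fintype.linearIndependent_iff]
  intro g hg c
  obtain ⟨e, he⟩ := (hC c).nonempty
  have h := congrFun hg e
  rw [sum_smul_indicator_apply hcomp, hcomp c e he, Set.indicator_of_mem he] at h
  simpa using h

theorem span_indicator_le [Fintype E] (hC : ∀ c, G.IsCycle (C c)) :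
    Submodule.span (ZMod 2) (Set.range fun c => (C c).indicator (1 : E → ZMod 2)) ≤
      LinearMap.ker (G.incidence (ZMod 2)).mulVecLin := by
  rw [Submodule.span_le]
  rintro _ ⟨c, rfl⟩
  exact (hC c).incidence_mulVec_indicator

end CycleFamily

/-- The unique cycles of the components form a basis of the cycle space over `ZMod 2`, so Euler's
relation cancels the number of components. -/
theorem IsMapGraph.card_eq [Fintype V] [Fintype E] (h : G.IsMapGraph) : Nat.card E = Nat.card V := by
  choose C hC huniq using fun c => h c
  have hcyc := fun c => (hC c).1
  have hcomp := fun c => (hC c).2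
  have hspan : Submodule.span (ZMod 2) (Set.range fun c => (C c).indicator (1 : E → ZMod 2)) =
      LinearMap.ker (G.incidence (ZMod 2)).mulVecLin := by
    refine le_antisymm (span_indicator_le hcyc) fun z hz => ?_
    -- The support of a nonzero `z` contains one of the given cycles; modulo two, subtracting it
    -- strictly shrinks the support.
    induction hn : (Function.support z).ncard using Nat.strong_induction_on generalizing z with
    | _ n ih =>
      by_cases hz0 : z = 0
      · rw [hz0]
        exact zero_mem _
      obtain ⟨D, hD, hDc⟩ := exists_isCycle_of_incidence_mulVec_eq_zero hz hz0
      obtain ⟨c, hc⟩ := hDc.exists_component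
      have hDC : D = C c := huniq c D ⟨hDc, hc⟩
      subst hDC
      have hmem : (C c).indicator (1 : E → ZMod 2) ∈
          LinearMap.ker (G.incidence (ZMod 2)).mulVecLin := (hcyc c).incidence_mulVec_indicator
      have hlt : (Function.support (z - (C c).indicator 1)).ncard < n := by
        rw [← hn]
        refine Set.ncard_lt_ncard ⟨fun e he => ?_, fun hsub => ?_⟩ (Set.toFinite _)
        · by_cases heC : e ∈ C c
          · exact hD heC
          · simpa [heC] using he
        · obtain ⟨e, he⟩ := hDc.nonempty
          have h1 : z e = 1 := zmod_two_eq_one (hD he)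
          exact hsub (hD he) (by simp [he, h1])
      have := ih _ hlt (z - (C c).indicator 1) (sub_mem hz hmem) rfl
      have h2 := add_mem this (Submodule.subset_span ⟨c, rfl⟩ : (C c).indicator (1 : E → ZMod 2) ∈
        Submodule.span (ZMod 2) (Set.range fun c => (C c).indicator (1 : E → ZMod 2)))
      rwa [sub_add_cancel] at h2
  have := Fintype.ofFinite G.Component
  have h1 := G.card_edges_add_card_component (ZMod 2)
  rw [← hspan, finrank_span_eq_card (linearIndependent_indicator hcyc hcomp),
    ← Nat.card_eq_fintype_card] at h1
  omega

/-- By Euler's relation the cycle space over `ZMod 2` has one dimension per component, so the chosen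
cycles span it. Their supports lie in different components, so any cycle inside one component is the
chosen one. -/
theorem isMapGraph_of_card_eq [Fintype V] [Fintype E] (hcard : Nat.card E = Nat.card V)
    (h : ∀ c, ∃ C : Set E, G.IsCycle C ∧ ∀ e ∈ C, G.component (G.tail e) = c) :
    G.IsMapGraph := by
  choose C hcyc hcomp using h
  have := Fintype.ofFinite G.Component
  have hspan : Submodule.span (ZMod 2) (Set.range fun c => (C c).indicator (1 : E → ZMod 2)) =
      LinearMap.ker (G.incidence (ZMod 2)).mulVecLin := by
    apply Submodule.eq_of_le_of_finrank_eq (span_indicator_le hcyc)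
    have h1 := G.card_edges_add_card_component (ZMod 2)
    rw [finrank_span_eq_card (linearIndependent_indicator hcyc hcomp), ← Nat.card_eq_fintype_card]
    omega
  refine fun c => ⟨C c, ⟨hcyc c, hcomp c⟩, fun D ⟨hD, hDc⟩ => ?_⟩
  have hmem : D.indicator (1 : E → ZMod 2) ∈
      LinearMap.ker (G.incidence (ZMod 2)).mulVecLin := hD.incidence_mulVec_indicator
  rw [← hspan, Submodule.mem_span_range_iff_exists_fun] at hmem
  obtain ⟨g, hg⟩ := hmem
  have key : ∀ e, D.indicator (1 : E → ZMod 2) e =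
      g (G.component (G.tail e)) * (C (G.component (G.tail e))).indicator 1 e := by
    intro e
    rw [← hg, sum_smul_indicator_apply hcomp]
  obtain ⟨e₀, he₀⟩ := hD.nonempty
  have h1 := key e₀
  rw [Set.indicator_of_mem he₀, hDc _ he₀] at h1
  have hgc : g c = 1 := by
    refine zmod_two_eq_one fun h0 => ?_
    rw [h0, zero_mul] at h1
    exact one_ne_zero (α := ZMod 2) h1
  ext e
  by_cases he : G.component (G.tail e) = c
  · have h2 := key e
    rw [he, hgc, one_mul] at h2
    by_cases h3 : e ∈ D <;> by_cases h4 : e ∈ C c <;> simp [h3, h4] at h2 ⊢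
  · exact ⟨fun h => absurd (hDc e h) he, fun h => absurd (hcomp c e h) he⟩

/-- A homomorphism to an abelian group is computed from the signed crossing numbers. -/
theorem Walk.map_rho [Fintype E] [Group Γ] {A : Type*} [CommGroup A] (π : Γ →* A) {u v : V}
    (p : G.Walk u v) : π p.rho = ∏ e, π (G.color e) ^ p.chain ℤ e := by
  have h1 : ∀ e : E, ∏ x, π (G.color x) ^ (Pi.single e 1 : E → ℤ) x = π (G.color e) := by
    intro e
    rw [Finset.prod_eq_single e (fun x _ hx => by rw [Pi.single_eq_of_ne hx, zpow_zero])
      (by simp), Pi.single_eq_same, zpow_one]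
  induction p with
  | nil v => simp [chain, rho]
  | fwd e hu hv p ih => simp [chain, rho, ih, zpow_add, Finset.prod_mul_distrib, h1]
  | bwd e hu hv p ih => simp [chain, rho, ih, zpow_add, Finset.prod_mul_distrib, h1]

/-- If all signed crossing numbers vanished, the image in the abelian group would be trivial. So
they form a nonzero integral cycle vector, whose support contains a cycle. It is applied to the
rotation part of `Γ_k`. -/
theorem Walk.exists_isCycle [Finite V] [Fintype E] [Group Γ] {A : Type*} [CommGroup A] (π : Γ →* A) {v : V}
    (p : G.Walk v v) (hp : π p.rho ≠ 1) :
    ∃ C : Set E, G.IsCycle C ∧ ∀ e ∈ C, G.component (G.tail e) = G.component v := by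
  have hne : p.chain ℤ ≠ 0 := by
    intro h
    apply hp
    simp [p.map_rho π, h]
  obtain ⟨C, hsub, hC⟩ := exists_isCycle_of_incidence_mulVec_eq_zero (G := G)
    (by rw [p.incidence_mulVec_chain ℤ, sub_self]) hne
  refine ⟨C, hC, fun e he => p.component_of_mem_edges ?_⟩
  by_contra h
  exact hsub he (p.chain_eq_zero_of_notMem ℤ h)

end Incidence

end ColoredGraph

/-! ### The affine action of `Γ_k` on `ℂ` -/

/-- The action of `Γ_k` on `ℂ` by rotations and translations that is given by a map `ℤ² → ℂ`. -/
def affineAct {k : ℕ} (τ : Fin 2 → ℂ) (g : Gam k) (x : ℂ) : ℂ :=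
  rotChar k g.right * x + latticeMap τ g.left

section AffineAct

variable {k : ℕ} {τ : Fin 2 → ℂ}

theorem affineAct_one (τ : Fin 2 → ℂ) (x : ℂ) : affineAct τ (1 : Gam k) x = x := by
  simp [affineAct, latticeMap_one]

theorem affineAct_mul (hτ : τ ∈ equivariantMaps k) (g h : Gam k) (x : ℂ) :
    affineAct τ (g * h) x = affineAct τ g (affineAct τ h x) := by
  simp only [affineAct, SemidirectProduct.mul_left, SemidirectProduct.mul_right, latticeMap_mul,
    latticeMap_rotAct hτ, map_mul, Circle.coe_mul]
  ring

theorem affineAct_inv_eq_iff (hτ : τ ∈ equivariantMaps k) (g : Gam k) (x y : ℂ) :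
    affineAct τ g⁻¹ x = y ↔ x = affineAct τ g y := by
  constructor
  · rintro rfl
    rw [← affineAct_mul hτ, mul_inv_cancel, affineAct_one]
  · rintro rfl
    rw [← affineAct_mul hτ, inv_mul_cancel, affineAct_one]

theorem isRotation_iff {g : Gam k} : IsRotation g ↔ g.right ≠ 1 := by
  rw [IsRotation, transGroup, SemidirectProduct.range_inl_eq_ker_rightHom, MonoidHom.mem_ker]
  rfl

theorem IsRotation.rotChar_ne_one (hk : k ≠ 0) {g : Gam k} (hg : IsRotation g) :
    (rotChar k g.right : ℂ) ≠ 1 := by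
  intro h
  refine isRotation_iff.1 hg (rotChar_injective hk ?_)
  rw [map_one]
  exact Circle.ext h

theorem affineAct_of_not_isRotation {g : Gam k} (hg : ¬ IsRotation g) (x : ℂ) :
    affineAct τ g x = x + latticeMap τ g.left := by
  rw [isRotation_iff, not_not] at hg
  simp [affineAct, hg]

/-- A subgroup whose translations act trivially has a fixed point. -/
theorem exists_fixed_point (hk : k ≠ 0) (hτ : τ ∈ equivariantMaps k) {H : Subgroup (Gam k)}
    (hH : ∀ g ∈ transPart H, latticeMap τ g.left = 0) :
    ∃ y, ∀ g ∈ H, affineAct τ g y = y := by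
  have htriv : ∀ g ∈ H, ¬ IsRotation g → ∀ x, affineAct τ g x = x := by
    intro g hg hr x
    rw [affineAct_of_not_isRotation hr, hH g ⟨hg, not_not.1 hr⟩, add_zero]
  by_cases hrot : ∃ g ∈ H, IsRotation g
  · obtain ⟨g, hg, hgr⟩ := hrot
    have ha : 1 - (rotChar k g.right : ℂ) ≠ 0 :=
      sub_ne_zero.2 (hgr.rotChar_ne_one hk).symm
    have huniq : ∀ y, affineAct τ g y = y ↔ y = latticeMap τ g.left / (1 - rotChar k g.right) := by
      intro y
      rw [eq_div_iff ha, affineAct]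
      constructor <;> intro h <;> linear_combination -h
    refine ⟨latticeMap τ g.left / (1 - rotChar k g.right), fun h hh => ?_⟩
    rw [← huniq, ← affineAct_mul hτ]
    -- The commutator is a translation in `H`, hence acts trivially. So `g` fixes the image under
    -- `h` of its own fixed point, and uniqueness makes `h` fix that point.
    have e : g * h = h * g * (g⁻¹ * h⁻¹ * g * h) := by group
    have hc : ¬ IsRotation (g⁻¹ * h⁻¹ * g * h) := by
      rw [isRotation_iff, not_not]
      simp only [SemidirectProduct.mul_right, SemidirectProduct.inv_right]
      rw [mul_right_comm, inv_mul_cancel_right, inv_mul_cancel]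
    rw [e, affineAct_mul hτ, htriv _ (H.mul_mem (H.mul_mem (H.mul_mem (H.inv_mem hg)
      (H.inv_mem hh)) hg) hh) hc, affineAct_mul hτ, (huniq _).2 rfl]
  · push Not at hrot
    exact ⟨0, fun g hg => htriv g hg (hrot g hg) 0⟩

/-- Vanishing on generators suffices, because the zeros of an additive map on `ℤ²` form a subgroup.
-/
theorem mem_annihilator_iSup {ι : Type*} {H : ι → Subgroup (Gam k)}
    (hH : ∀ i, H i ≤ transGroup k) {τ : equivariantMaps k} :
    τ ∈ annihilator (⨆ i, H i) ↔ ∀ i, ∀ g ∈ H i, latticeMap τ g.left = 0 := by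
  refine ⟨fun h i g hg => h g (le_iSup H i hg), fun h => ?_⟩
  let L : Multiplicative (Fin 2 → ℤ) →* Multiplicative ℂ :=
    MonoidHom.mk' (fun t => Multiplicative.ofAdd (latticeMap τ t)) fun s t => by
      rw [latticeMap_mul, ofAdd_add]
  have hle : ⨆ i, H i ≤ L.ker.map SemidirectProduct.inl := by
    refine iSup_le fun i g hg => ⟨g.left, ?_, inl_left_of_mem (hH i hg)⟩
    exact congrArg Multiplicative.ofAdd (h i g hg)
  intro g hg
  obtain ⟨t, ht, rfl⟩ := hle hg
  exact congrArg Multiplicative.toAdd (MonoidHom.mem_ker.1 ht)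

end AffineAct

theorem finrank_eq_finrank_map_snd_add_finrank_comap_inl {K W₁ W₂ : Type*} [Field K]
    [AddCommGroup W₁] [Module K W₁] [FiniteDimensional K W₁] [AddCommGroup W₂] [Module K W₂]
    [FiniteDimensional K W₂] (S : Submodule K (W₁ × W₂)) :
    Module.finrank K S = Module.finrank K (S.map (LinearMap.snd K W₁ W₂)) +
      Module.finrank K (S.comap (LinearMap.inl K W₁ W₂)) := by
  let φ := (LinearMap.snd K W₁ W₂).comp S.subtype
  have h1 : LinearMap.range φ = S.map (LinearMap.snd K W₁ W₂) := by
    rw [LinearMap.range_comp, Submodule.range_subtype]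
  have h2 : (LinearMap.ker φ).map S.subtype =
      (S.comap (LinearMap.inl K W₁ W₂)).map (LinearMap.inl K W₁ W₂) := by
    ext ⟨x, y⟩
    simp only [Submodule.mem_map, LinearMap.mem_ker, Submodule.mem_comap]
    constructor
    · rintro ⟨⟨⟨a, b⟩, hab⟩, hb, h⟩
      obtain rfl : b = 0 := hb
      exact ⟨a, hab, h⟩
    · rintro ⟨x', hx', h⟩
      exact ⟨⟨_, hx'⟩, rfl, h⟩
  rw [← h1, ← φ.finrank_range_add_finrank_ker, ← Submodule.finrank_map_subtype_eq, h2,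
    ← (Submodule.equivMapOfInjective _ LinearMap.inl_injective _).finrank_eq]

namespace ColoredGraph

/-! ### The linear system of a colored graph -/

variable {V E Γ : Type*}

theorem exists_walk [Group Γ] (G : ColoredGraph V E Γ) {u v : V}
    (h : G.component u = G.component v) : Nonempty (G.Walk u v) := by
  have h' := Quot.eqvGen_exact h
  clear h
  induction h' with
  | rel u v h =>
    obtain ⟨e, he⟩ := h
    exact ⟨Walk.fwd e he.1 he.2 (Walk.nil _)⟩
  | refl u => exact ⟨Walk.nil u⟩
  | symm u v h ih =>
    obtain ⟨p⟩ := ih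
    exact ⟨p.exists_reverse.choose⟩
  | trans u v w h1 h2 ih1 ih2 =>
    obtain ⟨p⟩ := ih1
    obtain ⟨q⟩ := ih2
    exact ⟨(p.exists_append q).choose⟩

variable {k : ℕ}

/-- The equation `x_tail = γ x_head` for a position of every vertex in `ℂ` and an action of `Γ_k`
on `ℂ`. -/
def edgeForm (G : ColoredGraph V E (Gam k)) (e : E) :
    Module.Dual ℂ ((V → ℂ) × equivariantMaps k) where
  toFun z := z.1 (G.tail e) - affineAct z.2 (G.color e) (z.1 (G.head e))
  map_add' y z := by
    simp only [affineAct, Prod.fst_add, Prod.snd_add, Pi.add_apply, Submodule.coe_add,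
      latticeMap_add]
    ring
  map_smul' c z := by
    simp only [affineAct, Prod.smul_fst, Prod.smul_snd, Pi.smul_apply, Submodule.coe_smul,
      latticeMap_smul, smul_eq_mul, RingHom.id_apply]
    ring

theorem edgeForm_apply_eq_zero {G : ColoredGraph V E (Gam k)} {e : E}
    {z : (V → ℂ) × equivariantMaps k} :
    G.edgeForm e z = 0 ↔ z.1 (G.tail e) = affineAct z.2 (G.color e) (z.1 (G.head e)) :=
  sub_eq_zero

/-- The common kernel of the edge forms. -/
def solutions (G : ColoredGraph V E (Gam k)) : Submodule ℂ ((V → ℂ) × equivariantMaps k) :=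
  (Submodule.span ℂ (Set.range G.edgeForm)).dualCoannihilator

variable {G : ColoredGraph V E (Gam k)}

theorem mem_solutions {z : (V → ℂ) × equivariantMaps k} : z ∈ G.solutions ↔
    ∀ e, z.1 (G.tail e) = affineAct z.2 (G.color e) (z.1 (G.head e)) := by
  simp only [solutions, Submodule.mem_dualCoannihilator, ← edgeForm_apply_eq_zero]
  refine ⟨fun h e => h _ (Submodule.subset_span ⟨e, rfl⟩), fun h φ hφ => ?_⟩
  induction hφ using Submodule.span_induction with
  | mem φ hφ => obtain ⟨e, rfl⟩ := hφ; exact h e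
  | zero => rfl
  | add φ ψ _ _ h1 h2 => rw [LinearMap.add_apply, h1, h2, add_zero]
  | smul c φ _ h1 => rw [LinearMap.smul_apply, h1, smul_zero]

/-- For closed walks this says that the position of the base vertex is fixed by the whole group of
its component. -/
theorem Walk.apply_eq_of_mem_solutions {z : (V → ℂ) × equivariantMaps k} (hz : z ∈ G.solutions)
    {u v : V} (p : G.Walk u v) : z.1 u = affineAct z.2 p.rho (z.1 v) := by
  rw [mem_solutions] at hz
  induction p with
  | nil v => rw [rho, affineAct_one]
  | fwd e hu hv p ih => rw [rho, affineAct_mul z.2.2, ← ih, ← hu, ← hv, hz]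
  | bwd e hu hv p ih =>
    rw [rho, affineAct_mul z.2.2, ← ih, eq_comm, affineAct_inv_eq_iff z.2.2, ← hu, ← hv, hz]

/-- A solution is obtained from fixed points of the groups of the components. -/
theorem exists_mem_solutions (τ : equivariantMaps k) (y : G.Component → ℂ)
    (hy : ∀ c, ∀ g ∈ G.rhoImage (G.base c), affineAct τ g (y c) = y c) :
    ∃ x : V → ℂ, (x, τ) ∈ G.solutions ∧ ∀ c, x (G.base c) = y c := by
  let q : ∀ v, G.Walk v (G.base (G.component v)) := fun v =>
    Classical.choice (G.exists_walk (G.component_base (G.component v)).symm)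
  let x : V → ℂ := fun v => affineAct τ (q v).rho (y (G.component v))
  -- The position does not depend on the walk: two walks to the base vertex differ by an element of
  -- the group that fixes `y c`.
  have hx : ∀ v c (p : G.Walk v (G.base c)), x v = affineAct τ p.rho (y c) := by
    intro v c p
    obtain rfl : G.component v = c := by rw [p.component_eq, component_base]
    obtain ⟨r, hr⟩ := p.exists_reverse
    obtain ⟨s, hs⟩ := r.exists_append (q v)
    have h1 : affineAct τ (p.rho * s.rho) (y (G.component v)) = _ := affineAct_mul τ.2 _ _ _
    rw [hy _ _ ⟨s, rfl⟩, hs, hr, mul_inv_cancel_left] at h1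
    exact h1
  refine ⟨x, mem_solutions.2 fun e => ?_, fun c => ?_⟩
  · change x (G.tail e) = affineAct τ (G.color e) (x (G.head e))
    rw [hx _ _ (Walk.fwd e rfl rfl (q (G.head e))), Walk.rho, affineAct_mul τ.2]
  · rw [hx _ _ (Walk.nil (G.base c)), Walk.rho, affineAct_one]

theorem eq_zero_of_mem_solutions {x : V → ℂ} (hx : (x, (0 : equivariantMaps k)) ∈ G.solutions)
    (h0 : ∀ c, x (G.base c) = 0) : x = 0 := by
  ext v
  obtain ⟨p⟩ := G.exists_walk (G.component_base (G.component v)).symm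
  have h := p.apply_eq_of_mem_solutions hx
  simpa [h0, affineAct, latticeMap] using h

/-- The components whose group contains no rotation. -/
def balanced (G : ColoredGraph V E (Gam k)) : Set G.Component :=
  {c | ∀ g ∈ G.rhoImage (G.base c), ¬ IsRotation g}

theorem exists_solution_of_balanced (y : G.Component → ℂ) (hy : ∀ c ∉ G.balanced, y c = 0) :
    ∃ x : V → ℂ, (x, (0 : equivariantMaps k)) ∈ G.solutions ∧ ∀ c, x (G.base c) = y c := by
  refine exists_mem_solutions 0 y fun c g hg => ?_
  by_cases hc : c ∈ G.balanced
  · rw [affineAct_of_not_isRotation (hc g hg)]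
    simp [latticeMap]
  · simp [hy c hc, affineAct, latticeMap]

theorem translations_le (G : ColoredGraph V E (Gam k)) : G.translations ≤ transGroup k :=
  iSup_le fun _ => inf_le_right

/-- A closed walk with translation value must move its base vertex by zero, which makes vanishing
necessary. Conversely the group of each component then has a fixed point, from which a solution is
built. -/
theorem map_snd_solutions (hk : k ≠ 0) (G : ColoredGraph V E (Gam k)) :
    G.solutions.map (LinearMap.snd ℂ (V → ℂ) (equivariantMaps k)) =
      annihilator G.translations := by
  ext τ
  refine Iff.trans ?_ (mem_annihilator_iSup (H := fun c => transPart (G.rhoImage (G.base c)))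
    fun _ => inf_le_right).symm
  constructor
  · rintro ⟨z, hz, rfl⟩ c g ⟨⟨p, rfl⟩, hg⟩
    have h := p.apply_eq_of_mem_solutions hz
    rw [affineAct_of_not_isRotation (not_not.2 hg)] at h
    simpa using h
  · intro h
    choose y hy using fun c => exists_fixed_point hk τ.2 (h c)
    obtain ⟨x, hx, -⟩ := exists_mem_solutions τ y hy
    exact ⟨(x, τ), hx, rfl⟩

-- With `τ = 0` the group acts by rotations about the origin: the position of a base vertex is free
-- if its group has no rotation, and zero otherwise.
open Classical in
theorem finrank_comap_inl_solutions [Finite V] (hk : k ≠ 0) (G : ColoredGraph V E (Gam k)) :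
    Module.finrank ℂ (G.solutions.comap (LinearMap.inl ℂ (V → ℂ) (equivariantMaps k))) =
      Nat.card G.balanced := by
  have := Fintype.ofFinite G.Component
  let φ : G.solutions.comap (LinearMap.inl ℂ (V → ℂ) (equivariantMaps k)) →ₗ[ℂ]
      (G.balanced → ℂ) :=
    { toFun := fun x c => x.1 (G.base c.1)
      map_add' := fun _ _ => rfl
      map_smul' := fun _ _ => rfl }
  have hφ : Function.Bijective φ := by
    constructor
    · refine (injective_iff_map_eq_zero φ).2 ?_
      rintro ⟨x, hx⟩ h0
      refine Subtype.ext (eq_zero_of_mem_solutions hx fun c => ?_)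
      by_cases hc : c ∈ G.balanced
      · exact congrFun h0 ⟨c, hc⟩
      · simp only [balanced, Set.mem_ofPred_eq, not_forall, not_not] at hc
        obtain ⟨g, ⟨p, rfl⟩, hg⟩ := hc
        have h1 : x (G.base c) = _ := p.apply_eq_of_mem_solutions hx
        have h3 : (1 - (rotChar k p.rho.right : ℂ)) * x (G.base c) = 0 := by
          simp [affineAct, latticeMap] at h1
          linear_combination h1
        exact (mul_eq_zero.1 h3).resolve_left (sub_ne_zero.2 (hg.rotChar_ne_one hk).symm)
    · intro y
      obtain ⟨x, hx, hxy⟩ := exists_solution_of_balanced (G := G)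
        (fun c => if hc : c ∈ G.balanced then y ⟨c, hc⟩ else 0) fun c hc => by simp [hc]
      refine ⟨⟨x, hx⟩, ?_⟩
      ext c
      exact (hxy c.1).trans (by simp)
  rw [(LinearEquiv.ofBijective φ hφ).finrank_eq, Module.finrank_fintype_fun_eq_card,
    Nat.card_eq_fintype_card]

theorem finrank_solutions [Finite V] (hk : k ≠ 0) (G : ColoredGraph V E (Gam k)) :
    Module.finrank ℂ G.solutions =
      Module.finrank ℂ (annihilator G.translations) + Nat.card G.balanced := by
  have := Fintype.ofFinite V
  rw [finrank_eq_finrank_map_snd_add_finrank_comap_inl, map_snd_solutions hk,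
    finrank_comap_inl_solutions hk]

theorem finrank_span_edgeForm [Finite V] (hk : k ≠ 0) (G : ColoredGraph V E (Gam k)) :
    Module.finrank ℂ (Submodule.span ℂ (Set.range G.edgeForm)) +
      (Module.finrank ℂ (annihilator G.translations) + Nat.card G.balanced) =
      Nat.card V + Module.finrank ℂ (equivariantMaps k) := by
  have := Fintype.ofFinite V
  rw [← finrank_solutions hk, solutions, Subspace.finrank_add_finrank_dualCoannihilator_eq,
    Module.finrank_prod, Module.finrank_fintype_fun_eq_card, Nat.card_eq_fintype_card]

theorem finsum_T [Finite V] (G : ColoredGraph V E (Gam k)) :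
    ∑ᶠ c : G.Component, (T (G.rhoImage (G.base c)) : ℝ) = 2 * Nat.card G.balanced := by
  classical
  have := Fintype.ofFinite G.Component
  have h : ∀ c, (T (G.rhoImage (G.base c)) : ℝ) = if c ∈ G.balanced then 2 else 0 := by
    intro c
    by_cases hc : ∃ g ∈ G.rhoImage (G.base c), IsRotation g
    · have : c ∉ G.balanced := fun h => by
        obtain ⟨g, hg, hr⟩ := hc
        exact h g hg hr
      simp [T, hc, this]
    · have : c ∈ G.balanced := by
        push Not at hc
        exact hc
      simp only [T, hc, this]
      simp
  rw [finsum_eq_sum_of_fintype, Finset.sum_congr rfl fun c _ => h c, ← Finset.sum_filter,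
    Finset.sum_const, nsmul_eq_mul, mul_comm, Nat.card_eq_fintype_card, Fintype.card_subtype]

/-- The sparsity function is twice the rank of the linear system. -/
theorem f_eq (hk : k = 2 ∨ k = 3 ∨ k = 4 ∨ k = 6) [Finite V] (G : ColoredGraph V E (Gam k)) :
    G.f = 2 * Module.finrank ℂ (Submodule.span ℂ (Set.range G.edgeForm)) := by
  have h1 := rep_add_finrank_annihilator hk G.translations_le
  have h2 : (Module.finrank ℂ (Submodule.span ℂ (Set.range G.edgeForm)) : ℝ) +
      (Module.finrank ℂ (annihilator G.translations) + Nat.card G.balanced) =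
      Nat.card V + Module.finrank ℂ (equivariantMaps k) := by
    exact_mod_cast finrank_span_edgeForm (by omega) G
  rw [f, finsum_T]
  linear_combination h1 - 2 * h2

/-- Restricting positions to the vertices of `H` is surjective, so its dual is injective and carries
the edge forms of `H` to those of `G`. The choice of vertices therefore does not affect the rank. -/
theorem finrank_span_edgeForm_toGraph (H : G.Subgraph) :
    Module.finrank ℂ (Submodule.span ℂ (Set.range H.toGraph.edgeForm)) =
      Module.finrank ℂ (Submodule.span ℂ (G.edgeForm '' H.edges)) := by
  let res : ((V → ℂ) × equivariantMaps k) →ₗ[ℂ] ((H.verts → ℂ) × equivariantMaps k) :=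
    (LinearMap.funLeft ℂ ℂ Subtype.val).prodMap LinearMap.id
  have hres : Function.Surjective res := by
    exact Prod.map_surjective.2
      ⟨LinearMap.funLeft_surjective_of_injective ℂ ℂ _ Subtype.val_injective,
        Function.surjective_id⟩
  have hinj := LinearMap.dualMap_injective_of_surjective hres
  have h : G.edgeForm '' H.edges = res.dualMap '' Set.range H.toGraph.edgeForm := by
    rw [← Set.range_comp, Set.image_eq_range]
    rfl
  rw [h, Submodule.span_image]
  exact (Submodule.equivMapOfInjective _ hinj _).finrank_eq

end ColoredGraph

namespace ColoredGraph

variable {V E : Type*} {k : ℕ}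

/-! ### Characterizations by rank -/

theorem isGamma22_iff (hk : k = 2 ∨ k = 3 ∨ k = 4 ∨ k = 6) [Finite V] [Fintype E]
    (G : ColoredGraph V E (Gam k)) :
    G.IsGamma22 ↔
      Nat.card E = 2 * (Nat.card V + Module.finrank ℂ (equivariantMaps k)) ∧
      ∀ F : Finset E, F.card ≤ 2 * spanRank (K := ℂ) G.edgeForm F := by
  have hf : ∀ H : G.Subgraph, (Nat.card H.edges : ℝ) ≤ H.toGraph.f ↔
      Nat.card H.edges ≤ 2 * Module.finrank ℂ (Submodule.span ℂ (G.edgeForm '' H.edges)) := by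
    intro H
    rw [f_eq hk, finrank_span_edgeForm_toGraph]
    exact_mod_cast Iff.rfl
  have h1 : (Nat.card E : ℝ) = 2 * (Nat.card V : ℝ) + rep (transGroup k) ↔
      Nat.card E = 2 * (Nat.card V + Module.finrank ℂ (equivariantMaps k)) := by
    rw [rep_transGroup hk, ← mul_add]
    exact_mod_cast Iff.rfl
  rw [IsGamma22, h1]
  refine and_congr Iff.rfl ⟨fun h F => ?_, fun h H => ?_⟩
  · have h2 := (hf ⟨Set.univ, F, fun _ _ => trivial, fun _ _ => trivial⟩).1 (h _)
    simpa [spanRank] using h2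
  · classical
    have h2 := h H.edges.toFinset
    rw [hf]
    rwa [spanRank, Set.coe_toFinset, Set.toFinset_card, ← Nat.card_eq_fintype_card] at h2

theorem span_edgeForm_eq_top [Finite V]
    {G : ColoredGraph V E (Gam k)}
    (h : Module.finrank ℂ (Submodule.span ℂ (Set.range G.edgeForm)) =
      Nat.card V + Module.finrank ℂ (equivariantMaps k)) :
    Submodule.span ℂ (Set.range G.edgeForm) = ⊤ := by
  have := Fintype.ofFinite V
  apply Submodule.eq_top_of_finrank_eq
  rw [h, Subspace.dual_finrank_eq, Module.finrank_prod, Module.finrank_fintype_fun_eq_card,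
    Nat.card_eq_fintype_card]

/-- A colored graph whose edge forms span the dual space contains a spanning map-graph. -/
theorem exists_isMapGraph [Finite V] [Finite E] {G : ColoredGraph V E (Gam k)}
    (h : Submodule.span ℂ (Set.range G.edgeForm) = ⊤) :
    ∃ F : Set E, (G.spanning F).IsMapGraph := by
  classical
  have := Fintype.ofFinite V
  -- Restricted to `τ = 0`, the edge forms still span the dual of `V → ℂ`. A basis among them uses
  -- exactly `n` edges, the number required of a map-graph.
  let π := (LinearMap.inl ℂ (V → ℂ) (equivariantMaps k)).dualMap
  have hπ : Function.Surjective π :=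
    LinearMap.dualMap_surjective_of_injective LinearMap.inl_injective
  have htop : Submodule.span ℂ (Set.range (π ∘ G.edgeForm)) = ⊤ := by
    rw [Set.range_comp, Submodule.span_image, h, Submodule.map_top, LinearMap.range_eq_top.2 hπ]
  obtain ⟨κ, a, ha, hspan, hli⟩ := exists_linearIndependent' ℂ (π ∘ G.edgeForm)
  rw [htop] at hspan
  have : Finite κ := Finite.of_injective a ha
  have := Fintype.ofFinite κ
  have hcard : Nat.card (Set.range a) = Nat.card V := by
    have h1 := finrank_span_eq_card hli
    rw [hspan, finrank_top, Subspace.dual_finrank_eq, Module.finrank_fintype_fun_eq_card] at h1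
    rw [Nat.card_range_of_injective ha, Nat.card_eq_fintype_card, Nat.card_eq_fintype_card, h1]
  have := Fintype.ofFinite (Set.range a)
  refine ⟨Set.range a, isMapGraph_of_card_eq hcard fun c => ?_⟩
  -- A component without rotation would carry a nonzero solution with `τ = 0`, killed by a spanning
  -- set of forms.
  have hc : c ∉ (G.spanning (Set.range a)).balanced := by
    intro hc
    obtain ⟨x, hx, hxb⟩ := exists_solution_of_balanced (G := G.spanning (Set.range a)) (Pi.single c 1)
      fun c' hc' => Pi.single_eq_of_ne (fun e => hc' (by rwa [e])) _
    have hx0 : ∀ φ : Module.Dual ℂ (V → ℂ), φ x = 0 := by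
      intro φ
      have hφ : φ ∈ Submodule.span ℂ (Set.range ((π ∘ G.edgeForm) ∘ a)) := hspan ▸ trivial
      induction hφ using Submodule.span_induction with
      | mem φ hφ =>
        obtain ⟨i, rfl⟩ := hφ
        exact edgeForm_apply_eq_zero.2 (mem_solutions.1 hx ⟨a i, i, rfl⟩)
      | zero => rfl
      | add φ ψ _ _ h1 h2 => rw [LinearMap.add_apply, h1, h2, add_zero]
      | smul c φ _ h1 => rw [LinearMap.smul_apply, h1, smul_zero]
    have h1 := hx0 (LinearMap.proj ((G.spanning (Set.range a)).base c))
    rw [LinearMap.proj_apply, hxb, Pi.single_eq_same] at h1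
    exact one_ne_zero h1
  simp only [balanced, Set.mem_ofPred_eq, not_forall, not_not] at hc
  obtain ⟨g, ⟨p, rfl⟩, hg⟩ := hc
  obtain ⟨C, hC, hCc⟩ := p.exists_isCycle SemidirectProduct.rightHom (isRotation_iff.1 hg)
  exact ⟨C, hC, fun e he => (hCc e he).trans ((G.spanning (Set.range a)).component_base c)⟩

/-- Conditions (ii) and (iii) say that both defects in the rank formula vanish, so that the rank is
full. A map-graph has `n` edges, so condition (i) fixes the number of edges, and full rank supplies
the map-graph. -/
theorem isGamma11_iff (hk : k = 2 ∨ k = 3 ∨ k = 4 ∨ k = 6) [Finite V] [Finite E]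
    (G : ColoredGraph V E (Gam k)) :
    G.IsGamma11 ↔ Nat.card E = Nat.card V + Module.finrank ℂ (equivariantMaps k) ∧
      Module.finrank ℂ (Submodule.span ℂ (Set.range G.edgeForm)) =
        Nat.card V + Module.finrank ℂ (equivariantMaps k) := by
  have hk0 : k ≠ 0 := by omega
  have := Fintype.ofFinite V
  have := Fintype.ofFinite E
  have hrank := finrank_span_edgeForm hk0 G
  have hrep := rep_add_finrank_annihilator hk G.translations_le
  have hbal : (∀ c : G.Component, ∃ g ∈ G.rhoImage (G.base c), IsRotation g) ↔
      Nat.card G.balanced = 0 := by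
    have : Finite G.balanced := Subtype.finite
    rw [Finite.card_eq_zero_iff, Set.isEmpty_coe_sort, Set.eq_empty_iff_forall_notMem]
    simp [balanced]
  have hann : rep G.translations = rep (transGroup k) ↔
      Module.finrank ℂ (annihilator G.translations) = 0 := by
    rw [rep_transGroup hk, ← hrep, ← Nat.cast_eq_zero (R := ℝ)]
    constructor <;> intro h <;> linarith
  have hcompl : ∀ F : Set E, (G.spanning F).IsMapGraph →
      ((Nat.card (Fᶜ : Set E) : ℝ) = rep (transGroup k) / 2 ↔
        Nat.card E = Nat.card V + Module.finrank ℂ (equivariantMaps k)) := by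
    intro F hF
    classical
    have h1 : Nat.card F = Nat.card V := hF.card_eq
    have h2 : Nat.card F + Nat.card (Fᶜ : Set E) = Nat.card E := by
      rw [Nat.card_coe_set_eq, Nat.card_coe_set_eq, Set.ncard_add_ncard_compl]
    rw [rep_transGroup hk, mul_div_cancel_left₀ _ two_ne_zero, Nat.cast_inj]
    omega
  rw [IsGamma11, hbal, hann]
  constructor
  · rintro ⟨⟨F, hF, hFc⟩, h1, h2⟩
    exact ⟨(hcompl F hF).1 hFc, by omega⟩
  · rintro ⟨h1, h2⟩
    obtain ⟨F, hF⟩ := exists_isMapGraph (span_edgeForm_eq_top h2)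
    exact ⟨⟨F, hF, (hcompl F hF).2 h1⟩, by omega, by omega⟩

theorem range_edgeForm_spanning (G : ColoredGraph V E (Gam k)) (F : Set E) :
    Set.range (G.spanning F).edgeForm = G.edgeForm '' F := by
  rw [Set.image_eq_range]
  rfl

end ColoredGraph

end CrystRig
end

/-! ### The proposition as a partition into two bases -/

theorem mainTheorem5 (k : ℕ) (hk : k = 2 ∨ k = 3 ∨ k = 4 ∨ k = 6)
    {V E : Type*} [Finite V] [Finite E] (G : CrystRig.ColoredGraph V E (CrystRig.Gam k)) :
    G.IsGamma22 ↔
      ∃ E₁ E₂ : Set E, Disjoint E₁ E₂ ∧ E₁ ∪ E₂ = Set.univ ∧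
        (G.spanning E₁).IsGamma11 ∧ (G.spanning E₂).IsGamma11 := by
  classical
  have := Fintype.ofFinite E
  have := Fintype.ofFinite V
  have h11 : ∀ X : Finset E, (G.spanning (X : Set E)).IsGamma11 ↔
      X.card = Nat.card V + Module.finrank ℂ (CrystRig.equivariantMaps k) ∧
      CrystRig.spanRank (K := ℂ) G.edgeForm X =
        Nat.card V + Module.finrank ℂ (CrystRig.equivariantMaps k) := by
    intro X
    rw [CrystRig.ColoredGraph.isGamma11_iff hk, CrystRig.ColoredGraph.range_edgeForm_spanning,
      Nat.card_coe_set_eq, Set.ncard_coe_finset]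
    rfl
  have hle : ∀ X : Finset E, CrystRig.spanRank (K := ℂ) G.edgeForm X ≤
      Nat.card V + Module.finrank ℂ (CrystRig.equivariantMaps k) := by
    intro X
    refine (Submodule.finrank_le _).trans ?_
    rw [Subspace.dual_finrank_eq, Module.finrank_prod, Module.finrank_fintype_fun_eq_card,
      Nat.card_eq_fintype_card]
  rw [CrystRig.ColoredGraph.isGamma22_iff hk, Nat.card_eq_fintype_card (α := E)]
  constructor
  · rintro ⟨hcard, hF⟩
    obtain ⟨X, h1, h2⟩ := CrystRig.exists_partition_of_card_le _ hF
    have h3 := X.card_add_card_compl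
    have h4 := hle X
    have h5 := hle Xᶜ
    -- Each part has size at most its rank, hence at most `n + d`; since the sizes add up to `2(n +
    -- d)`, all are equalities.
    refine ⟨X, (Xᶜ : Finset E), Finset.disjoint_coe.2 disjoint_compl_right, by simp,
      (h11 _).2 ⟨by omega, by omega⟩, (h11 _).2 ⟨by omega, by omega⟩⟩
  · rintro ⟨E₁, E₂, hdisj, hunion, h1, h2⟩
    obtain ⟨X, rfl⟩ := (Set.toFinite E₁).exists_finset_coe
    obtain rfl : E₂ = ((Xᶜ : Finset E) : Set E) := by
      rw [Finset.coe_compl]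
      exact (IsCompl.compl_eq ⟨hdisj, codisjoint_iff.2 hunion⟩).symm
    rw [h11] at h1 h2
    -- The part of an independent set inside `F` is independent, so it has at most `rank F`
    -- elements. Adding this over the two bases bounds `|F|`.
    have key : ∀ Y F : Finset E, CrystRig.spanRank (K := ℂ) G.edgeForm Y = Y.card →
        (F ∩ Y).card ≤ CrystRig.spanRank (K := ℂ) G.edgeForm F := by
      intro Y F hY
      have s1 := CrystRig.spanRank_submodular (K := ℂ) G.edgeForm (F ∩ Y) (Y \ F)
      have s2 := CrystRig.spanRank_le_card (K := ℂ) G.edgeForm (Y \ F)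
      have s3 := CrystRig.spanRank_mono (K := ℂ) G.edgeForm
        (Finset.inter_subset_left : F ∩ Y ⊆ F)
      have e1 : F ∩ Y ∪ Y \ F = Y := by ext; simp; tauto
      have e2 := Finset.card_sdiff_add_card_inter Y F
      rw [e1] at s1
      rw [Finset.inter_comm Y F] at e2
      omega
    refine ⟨by have := X.card_add_card_compl; omega, fun F => ?_⟩
    have k1 := key X F (by omega)
    have k2 := key Xᶜ F (by omega)
    have k3 : (F ∩ X).card + (F ∩ Xᶜ).card = F.card := by
      rw [← Finset.sdiff_eq_inter_compl]
      exact Finset.card_inter_add_card_sdiff F X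
    omega
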